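/- Let $p\ge 1$, $\theta_0\in\mathbb R^p$, and let $a_1,a_2,\dots$ be independent random vectors in $\mathbb R^p$ with coordinates $a_{ni}$, and $v_1,v_2,\dots$ real random variables with $E(v_n)=0$. For $N$ samples let $\mathbf A$ be the $N\times p$ matrix with rows $a_1^T,\dots,a_N^T$, let $\mathbf v=(v_1,\dots,v_N)^T$ and $\mathbf x=\mathbf A\theta_0+\mathbf v$, and let $\hat\theta^N=(\mathbf A^T\mathbf A)^{-1}\mathbf A^T\mathbf x$ be the least squares estimator. Assume: (A1) $P(|a_{ni}|\le\alpha)=1$ for all $n,i$; (A2) there is a positive definite matrix $\mathbf M\in\mathbb R^{p\times p}$ with $\mathbf M=\frac1N E(\mathbf A^T\mathbf A)$ for every $N>0$; let $\sigma_{\max}$ and $\sigma_{\min}$ be its largest and smallest eigenvalues; (A3) the $v_n$ are independent of each other, and the sequence $(v_n)$ is independent of the sequence $(a_n)$; (A4) $E(v_n^2)=R$ for all $n$; (A5) $P(|v_n|\le b)=1$ for all $n$. Then for all $\varepsilon,r>0$ and all integers $N\ge 0$ with $$N>\max\Big\{\tfrac43\,\tfrac{(6\sigma_{\max}+\sigma_{\min})(p\alpha^2+\sigma_{\max})}{\sigma_{\min}^2}\log\tfrac{3p}{\varepsilon},\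 \tfrac{2\alpha^2b^2}{r^2\sigma_{\min}^2}\log\tfrac{3p}{\varepsilon}\Big\}$$ the probability that $\mathbf A^T\mathbf A$ is singular (so that $\hat\theta^N$ is undefined) or $\|\hat\theta^N-\theta_0\|_\infty>r$ is at most $\varepsilon$. In particular $P(\|\hat\theta^N-\theta_0\|_\infty>r)\le\varepsilon$. -/

import Mathlib

open MeasureTheory ProbabilityTheory
open scoped Matrix

noncomputable section

namespace LeastSquares

/-- The largest (real) eigenvalue of a square matrix. -/
def lambdaMax {p : ℕ} (B : Matrix (Fin p) (Fin p) ℝ) : ℝ := sSup (spectrum ℝ B)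

/-- The smallest (real) eigenvalue of a square matrix. -/
def lambdaMin {p : ℕ} (B : Matrix (Fin p) (Fin p) ℝ) : ℝ := sInf (spectrum ℝ B)

/-- The entrywise expectation of a random matrix. -/
def expMatrix {Ω : Type*} [MeasurableSpace Ω] (P : Measure Ω) {m n : ℕ}
    (X : Ω → Matrix (Fin m) (Fin n) ℝ) : Matrix (Fin m) (Fin n) ℝ :=
  Matrix.of fun i j => ∫ ω, X ω i j ∂P

/-- The `N × p` design matrix whose rows are the first `N` terms of the sequence of random
row vectors `a`. -/
def design {Ω : Type*} {p : ℕ} (a : ℕ → Ω → Fin p → ℝ) (N : ℕ) (ω : Ω) :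
    Matrix (Fin N) (Fin p) ℝ :=
  Matrix.of fun n i => a n ω i

/-- The output `x = A θ₀ + v` of the linear model with `N` samples. -/
def output {Ω : Type*} {p : ℕ} (a : ℕ → Ω → Fin p → ℝ) (v : ℕ → Ω → ℝ) (θ₀ : Fin p → ℝ)
    (N : ℕ) (ω : Ω) : Fin N → ℝ :=
  design a N ω *ᵥ θ₀ + fun n : Fin N => v n ω

/-- The least squares estimator `(Aᵀ A)⁻¹ Aᵀ x`. It is meaningful when `Aᵀ A` is invertible. -/
def estimator {N p : ℕ} (A : Matrix (Fin N) (Fin p) ℝ) (x : Fin N → ℝ) : Fin p → ℝ :=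
  ((Aᵀ * A)⁻¹ * Aᵀ) *ᵥ x

/-- The number of samples needed to control the random design. -/
def nRand (p : ℕ) (α σmax σmin ε : ℝ) : ℝ :=
  4 / 3 * ((6 * σmax + σmin) * (p * α ^ 2 + σmax) / σmin ^ 2) * Real.log (3 * p / ε)

/-- The number of samples needed to control the bounded noise. -/
def nNoise (p : ℕ) (α b σmin r ε : ℝ) : ℝ :=
  2 * α ^ 2 * b ^ 2 / (r ^ 2 * σmin ^ 2) * Real.log (3 * p / ε)

end LeastSquares

end

/-! Write σ for the smallest eigenvalue of `M`, κ = α²/σ ≥ 1 and L = log(3p/ε), so that the target ε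
equals 3p·exp(-L). Whitening the rows gives isotropic vectors g_n with |g_n|² ≤ B = pκ and empirical
second moment matrix G. The conditions on N are used only through N ≥ (28/3)(B+1)L and the noise
bound.

Conditionally on the design, the i-th coordinate of the error is a weighted sum of the noise with
squared weights adding up to the (i,i) entry of the inverse Gram matrix. Hoeffding then gives at
most 2·exp(-κL/t_i), where t_i = y_iᵀG⁻¹y_i for vectors y_i satisfying a Bessel inequality. The t_i
are random and may exceed κ, so this bound is averaged over the design instead of being evaluated at
a worst case. It remains to fit P(G has an eigenvalue below 1/2) plus 2·E Σ exp(-κL/t_i) into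
3p·exp(-L): `measure_laplace_gt_add_lintegral_le`.

Everything about G comes from one Laplace transform bound, E tr exp(-sG) ≤ p·exp(-n(1 - exp(-s/n)))
with n = N/B. It follows by induction from a Golden–Thompson inequality for rank one perturbations,
`trace_exp_add_smul_vecMulVec_le`. Markov's inequality then controls small eigenvalues.

If κ ≥ 17/16, a Jensen-type inequality with constant 6/5 (`exp_neg_div_sum_le`) bounds Σ
exp(-κL/t_i) by a value of the Laplace transform. If κ ≤ 17/16, the exponent is split by 1/t ≥ 2 - t
into a part linear in G, handled by a Bernstein estimate (`lintegral_exp_quadratic_form_le`), and a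
remainder Σ w(1-d)²/d over the eigenvalues d of G. The exponential of the remainder is dominated by
a Gaussian mixture of Laplace transforms (`exp_le_mix`, `lintegral_mix_le`). -/

namespace LeastSquares

/-! ### Orthogonal diagonalization and functional calculus of real symmetric matrices. -/

section Diagonalization

open Matrix

variable {ι : Type*} [Fintype ι] [DecidableEq ι]

theorem exists_orthogonal_diagonalization {Q : Matrix ι ι ℝ} (hQ : Q.IsSymm) :
    ∃ (V : Matrix ι ι ℝ) (d : ι → ℝ), V * Vᵀ = 1 ∧ Vᵀ * V = 1 ∧ Q = V * diagonal d * Vᵀ := by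
  have hH : Q.IsHermitian := by rwa [IsHermitian, conjTranspose_eq_transpose_of_trivial]
  have h := hH.spectral_theorem
  refine ⟨hH.eigenvectorUnitary, hH.eigenvalues, ?_, ?_, ?_⟩
  · have := Unitary.coe_mul_star_self hH.eigenvectorUnitary
    rwa [Unitary.coe_star, star_eq_conjTranspose, conjTranspose_eq_transpose_of_trivial] at this
  · have := Unitary.coe_star_mul_self hH.eigenvectorUnitary
    rwa [star_eq_conjTranspose, conjTranspose_eq_transpose_of_trivial] at this
  · rw [Unitary.conjStarAlgAut_apply, star_eq_conjTranspose,
      conjTranspose_eq_transpose_of_trivial] at h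
    exact h

theorem exp_smul_of_diagonalization {V : Matrix ι ι ℝ} {d : ι → ℝ} (h1 : V * Vᵀ = 1) (s : ℝ) :
    NormedSpace.exp (s • (V * diagonal d * Vᵀ))
      = V * diagonal (fun j => Real.exp (s * d j)) * Vᵀ := by
  have hV : V⁻¹ = Vᵀ := inv_eq_right_inv h1
  have hu : IsUnit V := (isUnit_iff_isUnit_det _).2 (isUnit_det_of_right_inverse h1)
  have : s • (V * diagonal d * Vᵀ) = V * diagonal (s • d) * V⁻¹ := by
    rw [hV, diagonal_smul, mul_smul_comm, smul_mul_assoc]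
  rw [this, exp_conj _ _ hu, exp_diagonal, hV]
  congr 3
  funext j
  rw [Pi.coe_exp, Real.exp_eq_exp_ℝ]
  rfl

theorem trace_conj_diagonal {V : Matrix ι ι ℝ} {d : ι → ℝ} (h2 : Vᵀ * V = 1) :
    (V * diagonal d * Vᵀ).trace = ∑ j, d j := by
  rw [trace_mul_comm, ← mul_assoc, h2, one_mul, trace_diagonal]

theorem dotProduct_conj_diagonal_mulVec (V : Matrix ι ι ℝ) (d : ι → ℝ) (x : ι → ℝ) :
    x ⬝ᵥ ((V * diagonal d * Vᵀ) *ᵥ x) = ∑ j, d j * (Vᵀ *ᵥ x) j ^ 2 := by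
  rw [← mulVec_mulVec, ← mulVec_mulVec, dotProduct_mulVec, ← mulVec_transpose, dotProduct]
  refine Finset.sum_congr rfl fun j _ => ?_
  rw [mulVec_diagonal]; ring

theorem sum_sq_orthogonal_mulVec {V : Matrix ι ι ℝ} (h1 : V * Vᵀ = 1) (x : ι → ℝ) :
    ∑ j, (Vᵀ *ᵥ x) j ^ 2 = x ⬝ᵥ x := by
  have := dotProduct_conj_diagonal_mulVec V (fun _ => 1) x
  simpa [h1] using this.symm

end Diagonalization

/-! ### Golden–Thompson for rank one perturbations. -/

section RankOne

set_option linter.unusedSectionVars false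

open Matrix NormedSpace

/-- The derivative behind Duhamel's formula. -/
theorem hasDerivAt_exp_mul_exp {𝔸 : Type*} [NormedRing 𝔸] [NormedAlgebra ℝ 𝔸] [CompleteSpace 𝔸]
    (φ : 𝔸 →L[ℝ] ℝ) (K K' : 𝔸) (u v : ℝ) :
    HasDerivAt (fun v : ℝ => φ (exp ((u - v) • K) * exp (v • K')))
      (φ (exp ((u - v) • K) * (K' - K) * exp (v • K'))) v := by
  have h1 : HasDerivAt (fun v : ℝ => exp ((u - v) • K)) (-(exp ((u - v) • K) * K)) v := by
    have := (hasDerivAt_exp_smul_const (𝕂 := ℝ) K (u - v)).scomp v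
      ((hasDerivAt_id v).const_sub u)
    simpa [Function.comp_def] using this
  have h2 := hasDerivAt_exp_smul_const' (𝕂 := ℝ) K' v
  refine (φ.hasFDerivAt.comp_hasDerivAt v (h1.mul h2)).congr_deriv ?_
  congr 1
  noncomm_ring

variable {ι : Type*} [Fintype ι] [DecidableEq ι]

/-- The quadratic form `aᵀ X a` as a linear functional of `X`. -/
def quadLin (a : ι → ℝ) : Matrix ι ι ℝ →ₗ[ℝ] ℝ where
  toFun X := a ⬝ᵥ (X *ᵥ a)
  map_add' X Y := by rw [add_mulVec, dotProduct_add]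
  map_smul' c X := by rw [smul_mulVec, dotProduct_smul]; rfl

theorem quadLin_apply (a : ι → ℝ) (X : Matrix ι ι ℝ) : quadLin a X = a ⬝ᵥ (X *ᵥ a) := rfl

theorem quadLin_mul_vecMulVec_mul (a : ι → ℝ) (X Y : Matrix ι ι ℝ) :
    quadLin a (X * vecMulVec a a * Y) = quadLin a X * quadLin a Y := by
  simp only [quadLin_apply]
  rw [← mulVec_mulVec, ← mulVec_mulVec, vecMulVec_mulVec, mulVec_smul, dotProduct_smul]
  simp

section Norms

open scoped Matrix.Norms.Operator

theorem continuous_quadLin (a : ι → ℝ) : Continuous (quadLin a) :=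
  (quadLin a).continuous_of_finiteDimensional

theorem continuous_exp_matrix : Continuous (NormedSpace.exp : Matrix ι ι ℝ → Matrix ι ι ℝ) := by
  let _ : NormedAlgebra ℚ (Matrix ι ι ℝ) := NormedAlgebra.restrictScalars ℚ ℝ _
  exact NormedSpace.exp_continuous

theorem hasDerivAt_quadLin_exp_mul_exp (a : ι → ℝ) (K : Matrix ι ι ℝ) (s u v : ℝ) :
    HasDerivAt (fun v : ℝ => quadLin a
        (exp ((u - v) • K) * exp (v • (K + s • vecMulVec a a))))
      (s * (quadLin a (exp ((u - v) • K)) * quadLin a (exp (v • (K + s • vecMulVec a a))))) v := by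
  have h := hasDerivAt_exp_mul_exp (𝔸 := Matrix ι ι ℝ)
    ⟨quadLin a, continuous_quadLin a⟩ K (K + s • vecMulVec a a) u v
  have e : exp ((u - v) • K) * (K + s • vecMulVec a a - K) * exp (v • (K + s • vecMulVec a a))
      = s • (exp ((u - v) • K) * vecMulVec a a * exp (v • (K + s • vecMulVec a a))) := by
    rw [add_sub_cancel_left, mul_smul_comm, smul_mul_assoc]
  rw [← quadLin_mul_vecMulVec_mul, ← smul_eq_mul, ← map_smul, ← e]
  exact h

end Norms

theorem quadLin_exp_eq_sum {V : Matrix ι ι ℝ} {d : ι → ℝ} (h1 : V * Vᵀ = 1) (a : ι → ℝ) (s : ℝ) :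
    quadLin a (exp (s • (V * diagonal d * Vᵀ)))
      = ∑ j, Real.exp (s * d j) * (Vᵀ *ᵥ a) j ^ 2 := by
  rw [exp_smul_of_diagonalization h1, quadLin_apply, dotProduct_conj_diagonal_mulVec]

theorem quadLin_exp_nonneg {K : Matrix ι ι ℝ} (hK : K.IsSymm) (a : ι → ℝ) :
    0 ≤ quadLin a (exp K) := by
  obtain ⟨V, d, h1, -, rfl⟩ := exists_orthogonal_diagonalization hK
  have := quadLin_exp_eq_sum (d := d) h1 a 1
  rw [one_smul] at this
  rw [this]
  positivity

theorem quadLin_exp_pos {K : Matrix ι ι ℝ} (hK : K.IsSymm) {a : ι → ℝ} (ha : 0 < a ⬝ᵥ a) :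
    0 < quadLin a (exp K) := by
  obtain ⟨V, d, h1, -, rfl⟩ := exists_orthogonal_diagonalization hK
  have := quadLin_exp_eq_sum (d := d) h1 a 1
  rw [one_smul] at this
  rw [this]
  rw [← sum_sq_orthogonal_mulVec h1] at ha
  obtain ⟨j, -, hj⟩ := Finset.exists_ne_zero_of_sum_ne_zero ha.ne'
  refine Finset.sum_pos' (fun i _ => by positivity) ⟨j, Finset.mem_univ _, ?_⟩
  have : 0 < (Vᵀ *ᵥ a) j ^ 2 := lt_of_le_of_ne (sq_nonneg _) (Ne.symm hj)
  positivity

/-- Chebyshev's inequality for the moments `aᵀ e^{uK} a`. -/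
theorem quadLin_exp_mul_le {K : Matrix ι ι ℝ} (hK : K.IsSymm) (a : ι → ℝ) {u v : ℝ}
    (hu : 0 ≤ u) (hv : 0 ≤ v) :
    quadLin a (exp (u • K)) * quadLin a (exp (v • K))
      ≤ (a ⬝ᵥ a) * quadLin a (exp ((u + v) • K)) := by
  obtain ⟨V, d, h1, -, rfl⟩ := exists_orthogonal_diagonalization hK
  simp only [quadLin_exp_eq_sum h1, ← sum_sq_orthogonal_mulVec h1 a]
  set w : ι → ℝ := fun j => (Vᵀ *ᵥ a) j ^ 2
  have hw : ∀ j, 0 ≤ w j := fun j => sq_nonneg _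
  change (∑ j, Real.exp (u * d j) * w j) * (∑ j, Real.exp (v * d j) * w j)
    ≤ (∑ j, w j) * ∑ j, Real.exp ((u + v) * d j) * w j
  -- Both exponentials increase with `d` because `u` and `v` are nonnegative, so the two differences
  -- have the same sign.
  have key : 0 ≤ ∑ i, ∑ j, w i * w j * ((Real.exp (u * d i) - Real.exp (u * d j))
      * (Real.exp (v * d i) - Real.exp (v * d j))) := by
    refine Finset.sum_nonneg fun i _ => Finset.sum_nonneg fun j _ => ?_
    refine mul_nonneg (mul_nonneg (hw i) (hw j)) ?_
    rcases le_total (d i) (d j) with h | h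
    · refine mul_nonneg_of_nonpos_of_nonpos ?_ ?_ <;> rw [sub_nonpos] <;> gcongr
    · refine mul_nonneg ?_ ?_ <;> rw [sub_nonneg] <;> gcongr
  have e : ∀ i j, w i * w j * ((Real.exp (u * d i) - Real.exp (u * d j))
      * (Real.exp (v * d i) - Real.exp (v * d j)))
      = (Real.exp ((u + v) * d i) * w i) * w j + w i * (Real.exp ((u + v) * d j) * w j)
        - (Real.exp (u * d i) * w i) * (Real.exp (v * d j) * w j)
        - (Real.exp (v * d i) * w i) * (Real.exp (u * d j) * w j) := by
    intro i j
    rw [add_mul, Real.exp_add, add_mul, Real.exp_add]; ring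
  simp only [e, Finset.sum_sub_distrib, Finset.sum_add_distrib, ← Finset.sum_mul_sum] at key
  linarith

theorem continuous_quadLin_exp_smul (a : ι → ℝ) (K : Matrix ι ι ℝ) :
    Continuous fun u : ℝ => quadLin a (exp (u • K)) :=
  (continuous_quadLin a).comp (continuous_exp_matrix.comp (by fun_prop))

theorem isSymm_add_smul_vecMulVec {K : Matrix ι ι ℝ} (hK : K.IsSymm) (s : ℝ) (a : ι → ℝ) :
    (K + s • vecMulVec a a).IsSymm :=
  hK.add ((show (vecMulVec a a).IsSymm from transpose_vecMulVec a a).smul s)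

/-- Duhamel's formula expresses the growth of aᵀexp(uK')a over aᵀexp(uK)a as a convolution of the
two. Chebyshev's inequality turns this into an integral inequality for their ratio, and Grönwall's
argument at u = 1 finishes. -/
theorem quadLin_exp_add_le {K : Matrix ι ι ℝ} (hK : K.IsSymm) (a : ι → ℝ) {s : ℝ} (hs : 0 ≤ s) :
    quadLin a (exp (K + s • vecMulVec a a))
      ≤ Real.exp (s * (a ⬝ᵥ a)) * quadLin a (exp K) := by
  rcases eq_or_ne a 0 with rfl | ha
  · simp [quadLin_apply]
  set k := a ⬝ᵥ a with hk
  have hk0 : 0 < k := by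
    refine lt_of_le_of_ne (Finset.sum_nonneg fun i _ => mul_self_nonneg _) (Ne.symm ?_)
    rwa [Ne, dotProduct_self_eq_zero]
  set K' := K + s • vecMulVec a a with hK'
  set g : ℝ → ℝ := fun u => quadLin a (exp (u • K)) with hg
  set g' : ℝ → ℝ := fun u => quadLin a (exp (u • K')) with hg'
  have hgc : Continuous g := continuous_quadLin_exp_smul a K
  have hgc' : Continuous g' := continuous_quadLin_exp_smul a K'
  have hgpos : ∀ u, 0 < g u := fun u => quadLin_exp_pos (hK.smul u) hk0
  have hgnn' : ∀ u, 0 ≤ g' u := fun u =>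
    quadLin_exp_nonneg ((isSymm_add_smul_vecMulVec hK s a).smul u) a
  set r : ℝ → ℝ := fun u => g' u / g u with hr
  have hrc : Continuous r := hgc'.div hgc fun u => (hgpos u).ne'
  have hI : ∀ u, 0 ≤ u → r u ≤ 1 + s * k * ∫ v in (0 : ℝ)..u, r v := by
    intro u hu
    have h1 : ∫ v in (0 : ℝ)..u, s * (g (u - v) * g' v) = g' u - g u := by
      rw [intervalIntegral.integral_eq_sub_of_hasDerivAt
        (fun v _ => hasDerivAt_quadLin_exp_mul_exp a K s u v)]
      · simp [hg, hg', hK']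
      · exact (by fun_prop : Continuous fun v => s * (g (u - v) * g' v)).intervalIntegrable _ _
    have h2 : ∫ v in (0 : ℝ)..u, s * (g (u - v) * g' v) ≤ ∫ v in (0 : ℝ)..u, s * k * g u * r v := by
      refine intervalIntegral.integral_mono_on hu
        (by fun_prop : Continuous fun v => s * (g (u - v) * g' v)).continuousOn.intervalIntegrable
        (by fun_prop : Continuous fun v => s * k * g u * r v).continuousOn.intervalIntegrable ?_
      intro v hv
      have h3 := quadLin_exp_mul_le hK a (u := u - v) (v := v) (by linarith [hv.2]) hv.1
      rw [sub_add_cancel] at h3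
      have h4 : g' v = g v * r v := by rw [hr]; field_simp [(hgpos v).ne']
      rw [h4]
      have h5 : 0 ≤ r v := div_nonneg (hgnn' v) (hgpos v).le
      calc s * (g (u - v) * (g v * r v)) = s * ((g (u - v) * g v) * r v) := by ring
        _ ≤ s * ((k * g u) * r v) := by gcongr
        _ = _ := by ring
    rw [h1, intervalIntegral.integral_const_mul] at h2
    rw [hr, div_le_iff₀ (hgpos u)]
    linarith
  -- Grönwall's integrating factor: `hI` makes this function nonincreasing.
  set E : ℝ → ℝ := fun u => Real.exp (-(s * k * u)) * (1 + s * k * ∫ v in (0 : ℝ)..u, r v) with hE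
  have hEd : ∀ u, HasDerivAt E (Real.exp (-(s * k * u)) * (s * k) *
      (r u - (1 + s * k * ∫ v in (0 : ℝ)..u, r v))) u := by
    intro u
    have h1 : HasDerivAt (fun u => ∫ v in (0 : ℝ)..u, r v) (r u) u :=
      intervalIntegral.integral_hasDerivAt_right (hrc.intervalIntegrable _ _)
        (hrc.stronglyMeasurableAtFilter _ _) hrc.continuousAt
    have h2 : HasDerivAt (fun u : ℝ => Real.exp (-(s * k * u)))
        (Real.exp (-(s * k * u)) * (-(s * k * 1))) u :=
      (((hasDerivAt_id u).const_mul (s * k)).neg).exp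
    refine (h2.mul ((h1.const_mul (s * k)).const_add 1)).congr_deriv ?_
    ring
  have hE1 : E 1 ≤ E 0 := by
    refine antitoneOn_of_deriv_nonpos (convex_Icc 0 1)
      (fun u _ => (hEd u).continuousAt.continuousWithinAt)
      (fun u _ => (hEd u).differentiableAt.differentiableWithinAt) ?_
      (Set.left_mem_Icc.2 zero_le_one) (Set.right_mem_Icc.2 zero_le_one) zero_le_one
    intro u hu
    rw [interior_Icc] at hu
    rw [(hEd u).deriv]
    exact mul_nonpos_of_nonneg_of_nonpos (by positivity) (by linarith [hI u hu.1.le])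
  have h1 := hI 1 zero_le_one
  simp only [hE, mul_one, mul_zero, neg_zero, Real.exp_zero, intervalIntegral.integral_same,
    add_zero] at hE1
  rw [Real.exp_neg, inv_mul_le_iff₀ (Real.exp_pos _), mul_one] at hE1
  have h2 : r 1 ≤ Real.exp (s * k) := h1.trans hE1
  rw [hr, div_le_iff₀ (hgpos 1)] at h2
  simpa [hg, hg'] using h2

theorem trace_diagonal_mul_mul_diagonal_mul (l m : ι → ℝ) (O : Matrix ι ι ℝ) :
    (diagonal l * O * diagonal m * Oᵀ).trace = ∑ k, ∑ j, l k * m j * O k j ^ 2 := by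
  simp only [trace, diag_apply, mul_apply (N := Oᵀ), mul_diagonal, diagonal_mul, transpose_apply]
  refine Finset.sum_congr rfl fun k _ => Finset.sum_congr rfl fun j _ => ?_
  ring

/-- Convexity of `tr exp`. -/
theorem trace_exp_ge {A B : Matrix ι ι ℝ} (hA : A.IsSymm) (hB : B.IsSymm) :
    (exp B).trace + ((A - B) * exp B).trace ≤ (exp A).trace := by
  obtain ⟨U, l, hU1, hU2, rfl⟩ := exists_orthogonal_diagonalization hA
  obtain ⟨V, m, hV1, hV2, rfl⟩ := exists_orthogonal_diagonalization hB
  have eA := exp_smul_of_diagonalization (d := l) hU1 1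
  have eB := exp_smul_of_diagonalization (d := m) hV1 1
  simp only [one_smul, one_mul] at eA eB
  set O := Uᵀ * V with hO
  have hO1 : O * Oᵀ = 1 := by
    rw [hO, transpose_mul, transpose_transpose, Matrix.mul_assoc, ← Matrix.mul_assoc V, hV1,
      Matrix.one_mul, hU2]
  have hO2 : Oᵀ * O = 1 := by
    rw [hO, transpose_mul, transpose_transpose, Matrix.mul_assoc, ← Matrix.mul_assoc U, hU1,
      Matrix.one_mul, hV2]
  have hrow : ∀ k, ∑ j, O k j ^ 2 = 1 := by
    intro k
    have := congrFun (congrFun hO1 k) k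
    simpa [mul_apply, sq] using this
  have hcol : ∀ j, ∑ k, O k j ^ 2 = 1 := by
    intro j
    have := congrFun (congrFun hO2 j) j
    simpa [mul_apply, sq] using this
  have h1 : (U * diagonal l * Uᵀ * (V * diagonal (fun j => Real.exp (m j)) * Vᵀ)).trace
      = ∑ k, ∑ j, l k * Real.exp (m j) * O k j ^ 2 := by
    rw [← trace_diagonal_mul_mul_diagonal_mul, Matrix.mul_assoc, Matrix.mul_assoc, trace_mul_comm,
      hO, transpose_mul, transpose_transpose]
    simp only [Matrix.mul_assoc]
  have h2 : (V * diagonal m * Vᵀ * (V * diagonal (fun j => Real.exp (m j)) * Vᵀ)).trace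
      = ∑ j, m j * Real.exp (m j) := by
    have : V * diagonal m * Vᵀ * (V * diagonal (fun j => Real.exp (m j)) * Vᵀ)
        = V * diagonal (fun j => m j * Real.exp (m j)) * Vᵀ := by
      rw [← diagonal_mul_diagonal]
      calc _ = V * diagonal m * (Vᵀ * V) * diagonal (fun j => Real.exp (m j)) * Vᵀ := by
            simp only [Matrix.mul_assoc]
        _ = _ := by rw [hV2]; simp only [Matrix.mul_assoc, Matrix.one_mul]
    rw [this, trace_conj_diagonal hV2]
  rw [Matrix.sub_mul, trace_sub, eA, eB, h1, h2, trace_conj_diagonal hU2, trace_conj_diagonal hV2]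
  -- The squared entries of `O` form a doubly stochastic matrix, so all traces become double sums
  -- with the same weights and the scalar tangent inequality for exp applies term by term.
  have e1 : ∑ k, Real.exp (l k) = ∑ k, ∑ j, Real.exp (l k) * O k j ^ 2 := by
    simp only [← Finset.mul_sum, hrow, mul_one]
  have e2 : ∀ f : ι → ℝ, ∑ j, f j = ∑ k, ∑ j, f j * O k j ^ 2 := by
    intro f
    rw [Finset.sum_comm]
    simp only [← Finset.mul_sum, hcol, mul_one]
  rw [e1, e2 fun j => Real.exp (m j), e2 fun j => m j * Real.exp (m j),
    ← Finset.sum_sub_distrib, ← Finset.sum_add_distrib]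
  refine Finset.sum_le_sum fun k _ => ?_
  rw [← Finset.sum_sub_distrib, ← Finset.sum_add_distrib]
  refine Finset.sum_le_sum fun j _ => ?_
  have h3 : Real.exp (m j) * (1 + (l k - m j)) ≤ Real.exp (l k) := by
    calc _ ≤ Real.exp (m j) * Real.exp (l k - m j) := by
          gcongr; linarith [Real.add_one_le_exp (l k - m j)]
      _ = _ := by rw [← Real.exp_add]; ring_nf
  nlinarith [sq_nonneg (O k j)]

theorem trace_smul_vecMulVec_mul (a : ι → ℝ) (s : ℝ) (X : Matrix ι ι ℝ) :
    ((s • vecMulVec a a) * X).trace = s * quadLin a X := by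
  rw [smul_mul, trace_smul, smul_eq_mul, vecMulVec_mul, trace_vecMulVec, quadLin_apply,
    dotProduct_mulVec, dotProduct_comm]

/-- The tangent inequality `trace_exp_ge`, used at `s` and at `t`, traps the increment between
(t-s)f(s) and (t-s)f(t); continuity of f then gives the derivative without differentiating the
matrix exponential along noncommuting directions. -/
theorem hasDerivAt_trace_exp_add_smul_vecMulVec {K : Matrix ι ι ℝ} (hK : K.IsSymm) (a : ι → ℝ)
    (s : ℝ) : HasDerivAt (fun s : ℝ => (exp (K + s • vecMulVec a a)).trace)
      (quadLin a (exp (K + s • vecMulVec a a))) s := by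
  set f : ℝ → ℝ := fun s => quadLin a (exp (K + s • vecMulVec a a)) with hf
  set φ : ℝ → ℝ := fun s => (exp (K + s • vecMulVec a a)).trace with hφ
  have hfc : Continuous f :=
    (continuous_quadLin a).comp (continuous_exp_matrix.comp (by fun_prop))
  have key : ∀ s t, φ s + (t - s) * f s ≤ φ t := by
    intro s t
    have := trace_exp_ge (isSymm_add_smul_vecMulVec hK t a) (isSymm_add_smul_vecMulVec hK s a)
    rwa [add_sub_add_left_eq_sub, ← sub_smul, trace_smul_vecMulVec_mul] at this
  rw [hasDerivAt_iff_isLittleO, Asymptotics.isLittleO_iff]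
  intro c hc
  have hev : ∀ᶠ t in nhds s, |f t - f s| < c := by
    have := hfc.continuousAt.tendsto.eventually (Metric.ball_mem_nhds (f s) hc)
    simpa [Real.dist_eq] using this
  filter_upwards [hev] with t ht
  rw [smul_eq_mul, Real.norm_eq_abs, Real.norm_eq_abs]
  have h1 := key s t
  have h2 := key t s
  have h3 : φ t - φ s - (t - s) * f s ≤ (t - s) * (f t - f s) := by linarith
  rw [abs_of_nonneg (by change 0 ≤ φ t - φ s - (t - s) * f s; linarith)]
  refine h3.trans ((le_abs_self _).trans ?_)
  rw [abs_mul, mul_comm]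
  exact mul_le_mul_of_nonneg_right ht.le (abs_nonneg _)

/-- The Golden–Thompson inequality for a rank one perturbation. -/
theorem trace_exp_add_smul_vecMulVec_le {K : Matrix ι ι ℝ} (hK : K.IsSymm) (a : ι → ℝ) (s : ℝ)
    {B : ℝ} (hB : 0 < B) (haB : a ⬝ᵥ a ≤ B) :
    (exp (K + s • vecMulVec a a)).trace
      ≤ (exp K).trace + (Real.exp (s * B) - 1) / B * quadLin a (exp K) := by
  rcases eq_or_ne a 0 with rfl | ha
  · simp [quadLin_apply]
  set k := a ⬝ᵥ a with hk
  have hk0 : 0 < k := by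
    refine lt_of_le_of_ne (Finset.sum_nonneg fun i _ => mul_self_nonneg _) (Ne.symm ?_)
    rwa [Ne, dotProduct_self_eq_zero]
  set f : ℝ → ℝ := fun s => quadLin a (exp (K + s • vecMulVec a a)) with hf
  set φ : ℝ → ℝ := fun s => (exp (K + s • vecMulVec a a)).trace with hφ
  have hf0 : f 0 = quadLin a (exp K) := by simp [hf]
  have hφ0 : φ 0 = (exp K).trace := by simp [hφ]
  -- The derivative of `D` has the sign of its argument by `quadLin_exp_add_le`, so `D` is minimal
  -- at 0.
  set D : ℝ → ℝ := fun s => f 0 * ((Real.exp (s * k) - 1) / k) - φ s with hD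
  have hDd : ∀ s, HasDerivAt D (f 0 * Real.exp (s * k) - f s) s := by
    intro s
    have h1 : HasDerivAt (fun s : ℝ => f 0 * ((Real.exp (s * k) - 1) / k))
        (f 0 * (Real.exp (s * k) * (1 * k) / k)) s :=
      (((((hasDerivAt_id s).mul_const k).exp).sub_const 1).div_const k).const_mul _
    refine (h1.sub (hasDerivAt_trace_exp_add_smul_vecMulVec hK a s)).congr_deriv ?_
    rw [one_mul, mul_div_cancel_right₀ _ hk0.ne']
  have hDc : Continuous D := continuous_iff_continuousAt.2 fun s => (hDd s).continuousAt
  have hDdiff : Differentiable ℝ D := fun s => (hDd s).differentiableAt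
  have hmin : D 0 ≤ D s := by
    rcases le_total 0 s with hs | hs
    · refine monotoneOn_of_deriv_nonneg (convex_Ici 0) hDc.continuousOn hDdiff.differentiableOn ?_
        Set.self_mem_Ici hs hs
      intro t ht
      rw [interior_Ici] at ht
      have h1 := quadLin_exp_add_le hK a (le_of_lt ht)
      rw [(hDd t).deriv, hf0, sub_nonneg, mul_comm]
      exact h1
    · refine antitoneOn_of_deriv_nonpos (convex_Iic 0) hDc.continuousOn hDdiff.differentiableOn ?_
        hs Set.self_mem_Iic hs
      intro t ht
      rw [interior_Iic] at ht
      -- For negative `t` the roles are exchanged: the perturbed matrix is the base point and `-t`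
      -- leads back to `K`.
      have h1 := quadLin_exp_add_le (isSymm_add_smul_vecMulVec hK t a) a (s := -t)
        (by simpa using (le_of_lt ht))
      rw [neg_smul, add_neg_cancel_right] at h1
      rw [(hDd t).deriv, hf0, sub_nonpos]
      have h2 : Real.exp (t * k) * quadLin a (exp K)
          ≤ Real.exp (t * k) * (Real.exp (-t * k) * f t) := by gcongr
      rw [← mul_assoc, ← Real.exp_add] at h2
      simpa [mul_comm] using h2
  have h0 : D 0 = -φ 0 := by simp [hD]
  have h1 : φ s ≤ φ 0 + f 0 * ((Real.exp (s * k) - 1) / k) := by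
    have : D s = f 0 * ((Real.exp (s * k) - 1) / k) - φ s := rfl
    linarith
  -- Slopes of the convex exponential increase, for either sign of `s`; this replaces |a|² by the
  -- uniform bound `B`.
  have h2 : (Real.exp (s * k) - 1) / k ≤ (Real.exp (s * B) - 1) / B := by
    have hc : k / B ∈ Set.Icc (0 : ℝ) 1 := ⟨by positivity, (div_le_one hB).2 haB⟩
    have := convexOn_exp.2 (Set.mem_univ (s * B)) (Set.mem_univ 0) hc.1
      (sub_nonneg.2 hc.2) (add_sub_cancel _ _)
    simp only [smul_eq_mul, mul_zero, add_zero, Real.exp_zero, mul_one] at this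
    have e : k / B * (s * B) = s * k := by field_simp
    rw [e] at this
    rw [div_le_iff₀ hk0]
    calc _ ≤ k / B * Real.exp (s * B) + (1 - k / B) - 1 := by linarith
      _ = _ := by field_simp; ring
  have h3 : 0 ≤ f 0 := by rw [hf0]; exact quadLin_exp_nonneg hK a
  calc _ ≤ φ 0 + f 0 * ((Real.exp (s * k) - 1) / k) := h1
    _ ≤ φ 0 + f 0 * ((Real.exp (s * B) - 1) / B) := by gcongr
    _ = _ := by rw [hφ0, hf0]; ring

end RankOne

/-! ### Matrix Chernoff bound for isotropic rank one sums. -/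

section Chernoff

set_option linter.unusedSectionVars false

open Matrix NormedSpace

variable {ι : Type*} [Fintype ι] [DecidableEq ι]

theorem trace_exp_nonneg {K : Matrix ι ι ℝ} (hK : K.IsSymm) : 0 ≤ (exp K).trace := by
  obtain ⟨V, d, h1, h2, rfl⟩ := exists_orthogonal_diagonalization hK
  have := exp_smul_of_diagonalization (d := d) h1 1
  rw [one_smul] at this
  rw [this, trace_conj_diagonal h2]
  exact Finset.sum_nonneg fun j _ => (Real.exp_pos _).le

/-- The Gram matrix of finitely many vectors. -/
def gram {κ : Type*} (s : Finset κ) (x : κ → ι → ℝ) : Matrix ι ι ℝ :=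
  ∑ n ∈ s, vecMulVec (x n) (x n)

theorem isSymm_gram {κ : Type*} (s : Finset κ) (x : κ → ι → ℝ) : (gram s x).IsSymm := by
  rw [IsSymm, gram, transpose_sum]
  exact Finset.sum_congr rfl fun n _ => transpose_vecMulVec _ _

theorem continuous_gram {κ : Type*} (s : Finset κ) :
    Continuous fun x : κ → ι → ℝ => gram s x := by
  unfold gram
  exact continuous_finsetSum _ fun n _ =>
    (continuous_apply n).matrix_vecMulVec (continuous_apply n)

theorem continuous_trace_exp {X : Type*} [TopologicalSpace X] {f : X → Matrix ι ι ℝ}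
    (hf : Continuous f) : Continuous fun x => (exp (f x)).trace :=
  (continuous_exp_matrix.comp hf).matrix_trace

variable {Ω : Type*} [MeasurableSpace Ω] {P : Measure Ω} [IsProbabilityMeasure P]

theorem abs_le_sqrt_of_dotProduct_self_le {x : ι → ℝ} {B : ℝ} (h : x ⬝ᵥ x ≤ B) (k : ι) :
    |x k| ≤ √B := by
  refine Real.abs_le_sqrt (le_trans ?_ h)
  rw [sq]
  exact Finset.single_le_sum (f := fun k => x k * x k) (fun i _ => mul_self_nonneg _)
    (Finset.mem_univ k)

theorem integrable_mul_of_dotProduct_self_le {g : Ω → ι → ℝ} (hg : Measurable g) {B : ℝ}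
    (hB : ∀ᵐ ω ∂P, g ω ⬝ᵥ g ω ≤ B) (k l : ι) : Integrable (fun ω => g ω k * g ω l) P := by
  refine Integrable.of_bound (by fun_prop) (√B * √B) ?_
  filter_upwards [hB] with ω h
  rw [norm_mul]
  exact mul_le_mul (abs_le_sqrt_of_dotProduct_self_le h k)
    (abs_le_sqrt_of_dotProduct_self_le h l) (abs_nonneg _) (Real.sqrt_nonneg _)

theorem quadLin_eq_sum (a : ι → ℝ) (X : Matrix ι ι ℝ) :
    quadLin a X = ∑ k, ∑ l, X k l * (a k * a l) := by
  rw [quadLin_apply, dotProduct]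
  refine Finset.sum_congr rfl fun k _ => ?_
  rw [mulVec, dotProduct, Finset.mul_sum]
  exact Finset.sum_congr rfl fun l _ => by ring

theorem integrable_quadLin {g : Ω → ι → ℝ} (hg : Measurable g) {B : ℝ}
    (hB : ∀ᵐ ω ∂P, g ω ⬝ᵥ g ω ≤ B) (X : Matrix ι ι ℝ) :
    Integrable (fun ω => quadLin (g ω) X) P := by
  simp only [quadLin_eq_sum]
  exact integrable_finsetSum _ fun k _ => integrable_finsetSum _ fun l _ =>
    (integrable_mul_of_dotProduct_self_le hg hB k l).const_mul _

theorem integral_quadLin {g : Ω → ι → ℝ} (hg : Measurable g) {B : ℝ}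
    (hB : ∀ᵐ ω ∂P, g ω ⬝ᵥ g ω ≤ B)
    (hcov : ∀ k l, ∫ ω, g ω k * g ω l ∂P = (1 : Matrix ι ι ℝ) k l) (X : Matrix ι ι ℝ) :
    ∫ ω, quadLin (g ω) X ∂P = X.trace := by
  simp only [quadLin_eq_sum]
  have hi := fun k l => (integrable_mul_of_dotProduct_self_le hg hB k l).const_mul (X k l)
  rw [integral_finsetSum _ fun k _ => integrable_finsetSum _ fun l _ => hi k l]
  simp only [integral_finsetSum _ fun l _ => hi _ l, integral_const_mul, hcov]
  simp [one_apply, trace]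

/-- The rank one Golden–Thompson bound is linear in the quadratic form of exp K, whose mean is tr
exp K by isotropy. Hence one step costs the factor 1 + c ≤ exp c. -/
theorem lintegral_trace_exp_add_le {g : Ω → ι → ℝ} (hg : Measurable g) {B : ℝ} (hB0 : 0 < B)
    (hB : ∀ᵐ ω ∂P, g ω ⬝ᵥ g ω ≤ B)
    (hcov : ∀ k l, ∫ ω, g ω k * g ω l ∂P = (1 : Matrix ι ι ℝ) k l) (s : ℝ)
    {K : Matrix ι ι ℝ} (hK : K.IsSymm) :
    ∫⁻ ω, ENNReal.ofReal (exp (K + s • vecMulVec (g ω) (g ω))).trace ∂P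
      ≤ ENNReal.ofReal (exp K).trace * ENNReal.ofReal (Real.exp ((Real.exp (s * B) - 1) / B)) := by
  set c := (Real.exp (s * B) - 1) / B with hc
  have hle : ∀ᵐ ω ∂P, (exp (K + s • vecMulVec (g ω) (g ω))).trace
      ≤ (exp K).trace + c * quadLin (g ω) (exp K) := by
    filter_upwards [hB] with ω h
    exact trace_exp_add_smul_vecMulVec_le hK (g ω) s hB0 h
  have hi : Integrable (fun ω => (exp K).trace + c * quadLin (g ω) (exp K)) P :=
    (integrable_const _).add ((integrable_quadLin hg hB _).const_mul c)
  calc _ ≤ ∫⁻ ω, ENNReal.ofReal ((exp K).trace + c * quadLin (g ω) (exp K)) ∂P := by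
        refine lintegral_mono_ae ?_
        filter_upwards [hle] with ω h using ENNReal.ofReal_le_ofReal h
    _ = ENNReal.ofReal (∫ ω, ((exp K).trace + c * quadLin (g ω) (exp K)) ∂P) := by
        rw [ofReal_integral_eq_lintegral_ofReal hi]
        filter_upwards [hle] with ω h
        exact (trace_exp_nonneg (isSymm_add_smul_vecMulVec hK s (g ω))).trans h
    _ = ENNReal.ofReal ((exp K).trace * (1 + c)) := by
        rw [integral_add (integrable_const _) ((integrable_quadLin hg hB _).const_mul c),
          integral_const_mul, integral_quadLin hg hB hcov]
        simp only [integral_const, probReal_univ, one_smul]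
        ring_nf
    _ ≤ _ := by
        rw [← ENNReal.ofReal_mul (trace_exp_nonneg hK)]
        refine ENNReal.ofReal_le_ofReal (mul_le_mul_of_nonneg_left ?_ (trace_exp_nonneg hK))
        linarith [Real.add_one_le_exp c]

/-- The matrix Chernoff bound for sums of independent bounded isotropic rank one matrices. -/
theorem lintegral_trace_exp_smul_gram_le {g : ℕ → Ω → ι → ℝ} (hg : ∀ n, Measurable (g n))
    (hind : iIndepFun g P) {B : ℝ} (hB0 : 0 < B) (hB : ∀ n, ∀ᵐ ω ∂P, g n ω ⬝ᵥ g n ω ≤ B)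
    (hcov : ∀ n k l, ∫ ω, g n ω k * g n ω l ∂P = (1 : Matrix ι ι ℝ) k l) (s : ℝ) (N : ℕ) :
    ∫⁻ ω, ENNReal.ofReal (exp (s • gram (Finset.range N) fun n => g n ω)).trace ∂P
      ≤ ENNReal.ofReal (Fintype.card ι * Real.exp (N * ((Real.exp (s * B) - 1) / B))) := by
  induction N with
  | zero => simp [gram, trace_one]
  | succ N ih =>
    set c := (Real.exp (s * B) - 1) / B with hc
    -- The first `N` vectors are jointly independent of `g N`, so Fubini allows averaging over `g N`
    -- with the earlier sum frozen as `K`.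
    let X : Ω → (Finset.range N → ι → ℝ) := fun ω n => g n ω
    have hX : Measurable X := measurable_pi_lambda _ fun n => hg n
    let F : (Finset.range N → ι → ℝ) × (ι → ℝ) → ENNReal := fun z =>
      ENNReal.ofReal (exp (s • gram Finset.univ z.1 + s • vecMulVec z.2 z.2)).trace
    have hF : Measurable F := by
      refine ENNReal.measurable_ofReal.comp (Continuous.measurable (continuous_trace_exp ?_))
      exact (((continuous_gram _).comp continuous_fst).const_smul s).add
        ((continuous_snd.matrix_vecMulVec continuous_snd).const_smul s)
    have hgram : ∀ ω, gram Finset.univ (X ω) = gram (Finset.range N) fun n => g n ω := by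
      intro ω
      exact Finset.sum_coe_sort (Finset.range N) fun n => vecMulVec (g n ω) (g n ω)
    have hindep : IndepFun X (g N) P := by
      have h := hind.indepFun_finset (Finset.range N) {N} (by simp) hg
      exact h.comp (φ := id) (ψ := fun x : ({N} : Finset ℕ) → ι → ℝ =>
        x ⟨N, Finset.mem_singleton_self N⟩) measurable_id (measurable_pi_apply _)
    have e : ∀ ω, ENNReal.ofReal
        (exp (s • gram (Finset.range (N + 1)) fun n => g n ω)).trace = F (X ω, g N ω) := by
      intro ω
      change _ = ENNReal.ofReal (exp (s • gram Finset.univ (X ω) + s • _)).trace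
      rw [hgram, ← smul_add]
      congr 5
      exact Finset.sum_range_succ _ _
    have hmap := hindep.map_prod_eq_prod_map_map hX.aemeasurable (hg N).aemeasurable
    have : IsProbabilityMeasure (P.map (g N)) := Measure.isProbabilityMeasure_map (hg N).aemeasurable
    calc _ = ∫⁻ ω, F (X ω, g N ω) ∂P := lintegral_congr e
      _ = ∫⁻ z, F z ∂((P.map X).prod (P.map (g N))) := by
          rw [← hmap, lintegral_map hF (hX.prodMk (hg N))]
      _ = ∫⁻ x, ∫⁻ y, F (x, y) ∂(P.map (g N)) ∂(P.map X) := lintegral_prod _ hF.aemeasurable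
      _ = ∫⁻ ω, ∫⁻ ω', F (X ω, g N ω') ∂P ∂P := by
          rw [lintegral_map hF.lintegral_prod_right' hX]
          refine lintegral_congr fun ω => ?_
          exact lintegral_map (hF.comp measurable_prodMk_left) (hg N)
      _ ≤ ∫⁻ ω, ENNReal.ofReal (exp (s • gram (Finset.range N) fun n => g n ω)).trace
            * ENNReal.ofReal (Real.exp c) ∂P := by
          refine lintegral_mono fun ω => ?_
          rw [← hgram]
          exact lintegral_trace_exp_add_le (hg N) hB0 (hB N) (hcov N) s
            ((isSymm_gram _ _).smul s)
      _ ≤ ENNReal.ofReal (Fintype.card ι * Real.exp (N * c)) * ENNReal.ofReal (Real.exp c) := by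
          rw [lintegral_mul_const' _ _ ENNReal.ofReal_ne_top]
          gcongr
      _ = _ := by
          rw [← ENNReal.ofReal_mul (by positivity), mul_assoc, ← Real.exp_add]
          push_cast
          ring_nf

end Chernoff

/-! ### Gaussian mixtures of Laplace transforms. -/

section Mixture

/-- A sharp rational upper bound for `exp (-x) - 1 + x`. -/
theorem exp_neg_sub_one_add_le {x : ℝ} (hx : -3 < x) :
    x - 1 + Real.exp (-x) ≤ 3 * x ^ 2 / (2 * (3 + x)) := by
  -- The difference of the two sides times 3 + x. Its derivative `ψ` is monotone and vanishes at 0,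
  -- so `φ` is minimal there.
  set φ : ℝ → ℝ := fun x => 3 - 2 * x + x ^ 2 / 2 - (3 + x) * Real.exp (-x) with hφ
  set ψ : ℝ → ℝ := fun x => x - 2 + (2 + x) * Real.exp (-x) with hψ
  have he : ∀ x : ℝ, HasDerivAt (fun x : ℝ => Real.exp (-x)) (-Real.exp (-x)) x := fun x => by
    simpa using (hasDerivAt_id x).neg.exp
  have hφd : ∀ x, HasDerivAt φ (ψ x) x := by
    intro x
    have h1 : HasDerivAt (fun x : ℝ => 3 - 2 * x + x ^ 2 / 2) (-2 + x) x := by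
      have := (((hasDerivAt_id x).const_mul 2).const_sub 3).add
        (((hasDerivAt_id x).pow 2).div_const 2)
      refine this.congr_deriv ?_
      simp
    have h2 := ((hasDerivAt_id x).const_add 3).mul (he x)
    refine (h1.sub h2).congr_deriv ?_
    simp only [hψ, id]; ring
  have hψd : ∀ x, HasDerivAt ψ (1 - (1 + x) * Real.exp (-x)) x := by
    intro x
    have h1 := (hasDerivAt_id x).sub_const 2
    have h2 := ((hasDerivAt_id x).const_add 2).mul (he x)
    refine (h1.add h2).congr_deriv ?_
    simp only [id]; ring
  have hψm : Monotone ψ := by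
    refine monotone_of_deriv_nonneg (fun x => (hψd x).differentiableAt) fun x => ?_
    rw [(hψd x).deriv, Real.exp_neg, sub_nonneg, ← div_eq_mul_inv, div_le_one (Real.exp_pos _)]
    linarith [Real.add_one_le_exp x]
  have hψ0 : ψ 0 = 0 := by simp [hψ]
  have hφ0 : φ 0 = 0 := by simp [hφ]
  have hφc : Continuous φ := continuous_iff_continuousAt.2 fun s => (hφd s).continuousAt
  have hφdiff : Differentiable ℝ φ := fun s => (hφd s).differentiableAt
  have hmin : φ 0 ≤ φ x := by
    rcases le_total 0 x with hs | hs
    · refine monotoneOn_of_deriv_nonneg (convex_Ici 0) hφc.continuousOn hφdiff.differentiableOn ?_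
        Set.self_mem_Ici hs hs
      intro t ht
      rw [interior_Ici] at ht
      rw [(hφd t).deriv, ← hψ0]
      exact hψm (le_of_lt ht)
    · refine antitoneOn_of_deriv_nonpos (convex_Iic 0) hφc.continuousOn hφdiff.differentiableOn ?_
        hs Set.self_mem_Iic hs
      intro t ht
      rw [interior_Iic] at ht
      rw [(hφd t).deriv, ← hψ0]
      exact hψm (le_of_lt ht)
  rw [hφ0] at hmin
  rw [le_div_iff₀ (by linarith)]
  simp only [hφ] at hmin
  nlinarith

/-- The substitution x = √3·h + h²/2 is designed to make the Bernstein-type bound 3x²/(2(3+x)) at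
most quadratic in h, so that integrals over h become Gaussian. -/
theorem poisson_rate_le (h : ℝ) :
    (√3 * h + h ^ 2 / 2) - 1 + Real.exp (-(√3 * h + h ^ 2 / 2)) ≤ 3 / 2 * h ^ 2 := by
  have h3 : √3 ^ 2 = 3 := Real.sq_sqrt (by norm_num)
  have hx : -3 < √3 * h + h ^ 2 / 2 := by nlinarith [sq_nonneg (√3 + h)]
  refine (exp_neg_sub_one_add_le hx).trans ?_
  rw [div_le_iff₀ (by linarith)]
  have : (√3 * h + h ^ 2 / 2) ^ 2 = h ^ 2 * (3 + √3 * h + h ^ 2 / 4) := by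
    calc _ = h ^ 2 * (√3 ^ 2 + √3 * h + h ^ 2 / 4) := by ring
      _ = _ := by rw [h3]
  rw [this]
  nlinarith [mul_nonneg (sq_nonneg h) (sq_nonneg h)]

theorem lintegral_exp_quadratic {b : ℝ} (hb : 0 < b) (c d : ℝ) :
    ∫⁻ z : ℝ, ENNReal.ofReal (Real.exp (d + c * z - b * z ^ 2 / 2))
      = ENNReal.ofReal (√(2 * Real.pi / b) * Real.exp (d + c ^ 2 / (2 * b))) := by
  have e : ∀ z : ℝ, Real.exp (d + c * z - b * z ^ 2 / 2)
      = Real.exp (d + c ^ 2 / (2 * b)) * Real.exp (-(b / 2) * (z - c / b) ^ 2) := by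
    intro z
    rw [← Real.exp_add]
    congr 1
    field_simp
    ring
  simp only [e]
  have hi : Integrable fun z : ℝ => Real.exp (-(b / 2) * (z - c / b) ^ 2) :=
    (integrable_exp_neg_mul_sq (half_pos hb)).comp_sub_right (c / b)
  rw [← ofReal_integral_eq_lintegral_ofReal (hi.const_mul _)
    (Filter.Eventually.of_forall fun z => by positivity), integral_const_mul,
    integral_sub_right_eq_self (fun z : ℝ => Real.exp (-(b / 2) * z ^ 2)), integral_gaussian,
    mul_comm]
  congr 3
  field_simp

/-- The weight of the Gaussian mixture of exponentials dominating `exp (n (1 - x)² / (7 x))`. -/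
noncomputable def mixWeight (n z : ℝ) : ℝ :=
  √(17 / 3) / √(2 * Real.pi) * Real.exp (-(1 / 2) - 17 * n + 1
    + 17 / 3 * √(3 * n - 3 / 17) * z - 14 / 3 * (z ^ 2 / 2 - 3 * n / 2))

/-- A mixture of the values of a Laplace transform. -/
noncomputable def mix (n : ℝ) (t : ℝ → ℝ) : ENNReal :=
  ∫⁻ z, ENNReal.ofReal (mixWeight n z) * ENNReal.ofReal (t (z ^ 2 / 2 - 3 * n / 2))

theorem mixWeight_nonneg (n z : ℝ) : 0 ≤ mixWeight n z := by
  unfold mixWeight; positivity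

theorem continuous_mixWeight (n : ℝ) : Continuous (mixWeight n) := by
  unfold mixWeight; fun_prop

/-- The mixture is an explicit Gaussian integral in u = x + 14/3. Its constants are tuned at x = 1,
where u = 17/3: the value is 1 there, and the shift 3/17 under the root cancels the first order
effect of the prefactor √(17/(3u)). What remains is a multiple of (1-x)²/u. -/
theorem exp_le_mix {n x : ℝ} (hn : 10 ≤ n) (hx : 1 / 2 ≤ x) :
    ENNReal.ofReal (Real.exp (n / 7 * ((1 - x) ^ 2 / x)))
      ≤ mix n fun y => Real.exp (-y * x) := by
  have hA : √(3 * n - 3 / 17) ^ 2 = 3 * n - 3 / 17 := Real.sq_sqrt (by linarith)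
  set A := √(3 * n - 3 / 17) with hAdef
  set u := x + 14 / 3 with hu
  have hu0 : 0 < u := by linarith
  have e : ∀ z : ℝ, ENNReal.ofReal (mixWeight n z)
      * ENNReal.ofReal (Real.exp (-(z ^ 2 / 2 - 3 * n / 2) * x))
      = ENNReal.ofReal (√(17 / 3) / √(2 * Real.pi)) * ENNReal.ofReal (Real.exp
        ((-(1 / 2) - 17 * n + 1 + 3 * n / 2 * u) + 17 / 3 * A * z - u * z ^ 2 / 2)) := by
    intro z
    rw [← ENNReal.ofReal_mul (mixWeight_nonneg n z), ← ENNReal.ofReal_mul (by positivity),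
      mixWeight, mul_assoc, ← Real.exp_add]
    congr 3
    rw [hu]; ring
  rw [mix]
  simp only [e]
  rw [lintegral_const_mul' _ _ ENNReal.ofReal_ne_top, lintegral_exp_quadratic hu0,
    ← ENNReal.ofReal_mul (by positivity)]
  refine ENNReal.ofReal_le_ofReal ?_
  have h1 : √(17 / 3) / √(2 * Real.pi) * (√(2 * Real.pi / u) * Real.exp
      (-(1 / 2) - 17 * n + 1 + 3 * n / 2 * u + (17 / 3 * A) ^ 2 / (2 * u)))
      = √(17 / 3 / u) * Real.exp
      (-(1 / 2) - 17 * n + 1 + 3 * n / 2 * u + (17 / 3 * A) ^ 2 / (2 * u)) := by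
    rw [Real.sqrt_div (by positivity) u, Real.sqrt_div (by positivity) u]
    have : √(2 * Real.pi) ≠ 0 := by positivity
    field_simp
  rw [h1]
  have h2 : √(u / (17 / 3)) ≤ Real.exp ((u / (17 / 3) - 1) / 2) := by
    rw [Real.sqrt_le_left (Real.exp_pos _).le, ← Real.exp_nat_mul]
    push_cast
    rw [mul_div_cancel₀ _ two_ne_zero]
    linarith [Real.add_one_le_exp (u / (17 / 3) - 1)]
  have h3 : √(17 / 3 / u) * √(u / (17 / 3)) = 1 := by
    rw [← Real.sqrt_mul (by positivity)]
    field_simp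
    exact Real.sqrt_one
  have h4 : 1 ≤ √(17 / 3 / u) * Real.exp ((u / (17 / 3) - 1) / 2) := by
    exact h3.symm.le.trans (mul_le_mul_of_nonneg_left h2 (Real.sqrt_nonneg _))
  have h5 : n / 7 * ((1 - x) ^ 2 / x) + (u / (17 / 3) - 1) / 2 ≤
      -(1 / 2) - 17 * n + 1 + 3 * n / 2 * u + (17 / 3 * A) ^ 2 / (2 * u) := by
    have hx0 : 0 < x := by linarith
    have e1 : (17 / 3 * A) ^ 2 / (2 * u) = (17 / 3) ^ 2 * (3 * n - 3 / 17) / (2 * u) := by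
      rw [mul_pow, hA]
    have e2 : -(1 / 2) - 17 * n + 1 + 3 * n / 2 * u + (17 / 3 * A) ^ 2 / (2 * u)
        - (u / (17 / 3) - 1) / 2 = (3 * n / 2 - 3 / 34) * ((1 - x) ^ 2 / u) := by
      rw [e1]
      field_simp
      rw [hu]
      ring
    -- The ratio u/x is largest at x = 1/2, where it equals 31/3.
    have h6 : (1 - x) ^ 2 / x ≤ 31 / 3 * ((1 - x) ^ 2 / u) := by
      rw [mul_div_assoc', div_le_div_iff₀ hx0 hu0]
      have : u ≤ 31 / 3 * x := by rw [hu]; linarith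
      nlinarith [mul_le_mul_of_nonneg_left this (sq_nonneg (1 - x))]
    have h7 : 0 ≤ (1 - x) ^ 2 / u := by positivity
    have h8 : n / 7 * ((1 - x) ^ 2 / x) ≤ n / 7 * (31 / 3 * ((1 - x) ^ 2 / u)) := by gcongr
    have h9 : n / 7 * (31 / 3) * ((1 - x) ^ 2 / u)
        ≤ (3 * n / 2 - 3 / 34) * ((1 - x) ^ 2 / u) := by
      refine mul_le_mul_of_nonneg_right ?_ h7
      linarith
    linarith
  calc Real.exp (n / 7 * ((1 - x) ^ 2 / x))
      ≤ Real.exp (n / 7 * ((1 - x) ^ 2 / x))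
          * (√(17 / 3 / u) * Real.exp ((u / (17 / 3) - 1) / 2)) :=
        le_mul_of_one_le_right (Real.exp_pos _).le h4
    _ = √(17 / 3 / u) * Real.exp (n / 7 * ((1 - x) ^ 2 / x) + (u / (17 / 3) - 1) / 2) := by
        rw [Real.exp_add]; ring
    _ ≤ _ := by gcongr

theorem sum_exp_le_mix {ι : Type*} [Fintype ι] {n : ℝ} (hn : 10 ≤ n) {d : ι → ℝ}
    (hd : ∀ j, 1 / 2 ≤ d j) :
    ENNReal.ofReal (∑ j, Real.exp (n / 7 * ((1 - d j) ^ 2 / d j)))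
      ≤ mix n fun y => ∑ j, Real.exp (-y * d j) := by
  rw [ENNReal.ofReal_sum_of_nonneg fun j _ => (Real.exp_pos _).le]
  refine (Finset.sum_le_sum fun j _ => exp_le_mix hn (hd j)).trans_eq ?_
  simp only [mix]
  rw [← lintegral_finsetSum']
  · refine lintegral_congr fun z => ?_
    rw [← Finset.mul_sum, ENNReal.ofReal_sum_of_nonneg fun j _ => (Real.exp_pos _).le]
  · intro j _
    have := continuous_mixWeight n
    fun_prop

/-- After exchanging integrals, `poisson_rate_le` with z = √n(√3 + h) leaves a Gaussian of precision
17/3 - 3 = 8/3. The constant is therefore √(17/8) up to a factor exp(1/200). -/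
theorem lintegral_mix_le {Ω : Type*} [MeasurableSpace Ω] {P : Measure Ω} [IsProbabilityMeasure P]
    {T : Ω → ℝ → ℝ} (hT : Measurable (Function.uncurry T)) {n q : ℝ} (hn : 10 ≤ n) (hq : 0 ≤ q)
    (hE : ∀ y, ∫⁻ ω, ENNReal.ofReal (T ω y) ∂P
      ≤ ENNReal.ofReal (q * Real.exp (-(n * (1 - Real.exp (-(y / n))))))) :
    ∫⁻ ω, mix n (T ω) ∂P ≤ ENNReal.ofReal (733 / 500 * q) := by
  have hn0 : 0 < n := by linarith
  have hA : √(3 * n - 3 / 17) ^ 2 = 3 * n - 3 / 17 := Real.sq_sqrt (by linarith)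
  have hA0 : 0 ≤ √(3 * n - 3 / 17) := Real.sqrt_nonneg _
  have hz : √(3 * n) ^ 2 = 3 * n := Real.sq_sqrt (by linarith)
  have hz0 : 0 < √(3 * n) := Real.sqrt_pos.2 (by linarith)
  have hw := continuous_mixWeight n
  simp only [mix]
  have hm : Measurable fun x : Ω × ℝ => ENNReal.ofReal (mixWeight n x.2)
      * ENNReal.ofReal (T x.1 (x.2 ^ 2 / 2 - 3 * n / 2)) := by
    have h : Measurable fun x : Ω × ℝ => (x.1, x.2 ^ 2 / 2 - 3 * n / 2) := by fun_prop
    exact (hw.measurable.comp measurable_snd).ennreal_ofReal.mul (hT.comp h).ennreal_ofReal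
  rw [lintegral_lintegral_swap hm.aemeasurable]
  have step : ∀ z : ℝ, ∫⁻ ω, ENNReal.ofReal (mixWeight n z)
      * ENNReal.ofReal (T ω (z ^ 2 / 2 - 3 * n / 2)) ∂P
      ≤ ENNReal.ofReal (√(17 / 3) / √(2 * Real.pi) * q) * ENNReal.ofReal (Real.exp
        ((1 / 2 - 17 * n + 13 * n) + (17 / 3 * √(3 * n - 3 / 17) - 3 * √(3 * n)) * z
          - 8 / 3 * z ^ 2 / 2)) := by
    intro z
    rw [lintegral_const_mul' _ _ ENNReal.ofReal_ne_top]
    refine (mul_le_mul_right (hE _) _).trans ?_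
    rw [← ENNReal.ofReal_mul (mixWeight_nonneg n z), ← ENNReal.ofReal_mul (by positivity)]
    refine ENNReal.ofReal_le_ofReal ?_
    set h := (z - √(3 * n)) / √n with hh
    have hsn : √n ^ 2 = n := Real.sq_sqrt hn0.le
    have hsn0 : 0 < √n := Real.sqrt_pos.2 hn0
    have e3 : √(3 * n) = √3 * √n := Real.sqrt_mul (by norm_num) n
    have h3 : √3 ^ 2 = 3 := Real.sq_sqrt (by norm_num)
    have ez : z = √n * (√3 + h) := by
      rw [hh, e3]; field_simp; ring
    have ex : (z ^ 2 / 2 - 3 * n / 2) / n = √3 * h + h ^ 2 / 2 := by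
      rw [div_eq_iff hn0.ne', ez, mul_pow, hsn, add_sq, h3]; ring
    have hp := poisson_rate_le h
    rw [← ex] at hp
    set y := z ^ 2 / 2 - 3 * n / 2 with hy
    have hnh : n * h ^ 2 = (z - √(3 * n)) ^ 2 := by
      rw [hh, div_pow, hsn]; field_simp
    have hp2 : y - n * (1 - Real.exp (-(y / n))) ≤ y + (3 / 2 * (z - √(3 * n)) ^ 2 - y) := by
      have := mul_le_mul_of_nonneg_left hp hn0.le
      have e5 : n * (y / n) = y := by field_simp
      rw [← hnh]
      linarith
    rw [mixWeight, show ∀ a b c d : ℝ, a * b * (c * d) = a * c * (b * d) by intros; ring,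
      ← Real.exp_add]
    refine mul_le_mul_of_nonneg_left (Real.exp_le_exp.2 ?_) (by positivity)
    have e6 : (z - √(3 * n)) ^ 2 = z ^ 2 - 2 * z * √(3 * n) + 3 * n := by rw [sub_sq, hz]
    rw [e6] at hp2
    rw [hy] at hp2 ⊢
    linarith
  refine (lintegral_mono step).trans ?_
  rw [lintegral_const_mul' _ _ ENNReal.ofReal_ne_top, lintegral_exp_quadratic (by norm_num),
    ← ENNReal.ofReal_mul (by positivity)]
  refine ENNReal.ofReal_le_ofReal ?_
  set A := √(3 * n - 3 / 17)
  set Z := √(3 * n)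
  -- The terms of order n cancel exactly, leaving (51/16)(Z - A)², which is tiny since Z² - A² =
  -- 3/17.
  have hexp : 1 / 2 - 17 * n + 13 * n + (17 / 3 * A - 3 * Z) ^ 2 / (2 * (8 / 3)) ≤ 1 / 200 := by
    have hAZ : A ≤ Z := Real.sqrt_le_sqrt (by linarith)
    have hd : (Z - A) * (Z + A) = 3 / 17 := by nlinarith
    have hZ5 : 5 ≤ Z := by
      refine Real.le_sqrt_of_sq_le ?_
      linarith
    have hd2 : Z - A ≤ 3 / 85 := by nlinarith
    have e : 1 / 2 - 17 * n + 13 * n + (17 / 3 * A - 3 * Z) ^ 2 / (2 * (8 / 3))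
        = 51 / 16 * (Z - A) ^ 2 := by
      linear_combination (17 / 6) * hA - (3 / 2) * hz
    have h4 : (Z - A) ^ 2 ≤ (3 / 85) ^ 2 := by
      exact pow_le_pow_left₀ (by linarith) hd2 2
    rw [e]
    linarith
  have hpi : √(2 * Real.pi) ≠ 0 := by positivity
  have hs : √(17 / 3) / √(2 * Real.pi) * q * (√(2 * Real.pi / (8 / 3)) * Real.exp (1 / 200))
      = √(17 / 8) * Real.exp (1 / 200) * q := by
    rw [Real.sqrt_div (by positivity) (8 / 3), show (17 / 8 : ℝ) = 17 / 3 / (8 / 3) by norm_num,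
      Real.sqrt_div (by norm_num) (8 / 3)]
    field_simp
  have hnum : √(17 / 8) * Real.exp (1 / 200) ≤ 733 / 500 := by
    have h1 : Real.exp (1 / 200) ≤ 1.00503 := by
      have := Real.exp_bound_div_one_sub_of_interval (x := 1 / 200) (by norm_num) (by norm_num)
      refine this.trans ?_
      norm_num
    have h2 : √(17 / 8) ≤ 1.45774 := by
      rw [Real.sqrt_le_left (by norm_num)]; norm_num
    calc _ ≤ 1.45774 * (1.00503 : ℝ) := by gcongr
      _ ≤ _ := by norm_num
  calc _ ≤ √(17 / 3) / √(2 * Real.pi) * q * (√(2 * Real.pi / (8 / 3)) * Real.exp (1 / 200)) := by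
        gcongr
    _ = √(17 / 8) * Real.exp (1 / 200) * q := hs
    _ ≤ _ := by gcongr

end Mixture

/-! ### Scalar exponential inequalities and numerical tail bounds. -/

section Scalar

theorem exp_le_of_lt_three {y : ℝ} (hy : y < 3) :
    Real.exp y ≤ 1 + y + 3 * y ^ 2 / (2 * (3 - y)) := by
  have := exp_neg_sub_one_add_le (x := -y) (by linarith)
  rw [neg_neg, neg_sq, ← sub_eq_add_neg] at this
  linarith

theorem exp_le_quadratic {y : ℝ} (hy : y ≤ 3 / 10) : Real.exp y ≤ 1 + y + 5 / 9 * y ^ 2 := by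
  refine (exp_le_of_lt_three (by linarith)).trans ?_
  have : 3 * y ^ 2 / (2 * (3 - y)) ≤ 5 / 9 * y ^ 2 := by
    rw [div_le_iff₀ (by linarith)]
    nlinarith [sq_nonneg y]
  linarith

theorem exp_mul_two_sub_le {k : ℝ} (hk0 : 0 ≤ k) (hk : k ≤ 2) :
    Real.exp k * (2 - k) ≤ 2 + k := by
  have h := exp_le_of_lt_three (y := k) (by linarith)
  have e : 1 + k + 3 * k ^ 2 / (2 * (3 - k)) = (6 + 4 * k + k ^ 2) / (2 * (3 - k)) := by
    have : 3 - k ≠ 0 := by linarith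
    field_simp; ring
  rw [e] at h
  calc _ ≤ (6 + 4 * k + k ^ 2) / (2 * (3 - k)) * (2 - k) := by
        refine mul_le_mul_of_nonneg_right h (by linarith)
    _ ≤ _ := by
        rw [div_mul_eq_mul_div, div_le_iff₀ (by linarith)]
        nlinarith [pow_nonneg hk0 3]

theorem cubic_le_exp {h : ℝ} (hh : 0 ≤ h) : 1 + h + h ^ 2 / 2 + h ^ 3 / 6 ≤ Real.exp h := by
  have := Real.sum_le_exp_of_nonneg hh 4
  simp only [Finset.sum_range_succ, Finset.sum_range_zero, Nat.factorial] at this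
  norm_num at this
  linarith

/-- The left side is the tangent to u ↦ exp(-θ/u) at u = θ/q, evaluated at u = θ/p. Where the
function is concave the tangent may exceed it, and 6/5 pays for the excess as long as p ≥ 19/20. -/
theorem tangent_le {p q : ℝ} (hp : 19 / 20 ≤ p) (hq : 2 ≤ q) :
    Real.exp (-q) * (1 - q + q ^ 2 / p) ≤ 6 / 5 * Real.exp (-p) := by
  obtain ⟨h, rfl⟩ : ∃ h, q = p + h := ⟨q - p, by ring⟩
  have hp0 : 0 < p := by linarith
  have e1 : 1 - (p + h) + (p + h) ^ 2 / p = 1 + h + h ^ 2 / p := by field_simp; ring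
  suffices H : 1 + h + h ^ 2 / p ≤ 6 / 5 * Real.exp h by
    rw [e1]
    calc _ ≤ Real.exp (-(p + h)) * (6 / 5 * Real.exp h) := by gcongr
      _ = 6 / 5 * (Real.exp (-(p + h)) * Real.exp h) := by ring
      _ = _ := by rw [← Real.exp_add]; ring_nf
  rcases le_total 0 h with hh | hh
  · have hc := cubic_le_exp hh
    rcases le_total 2 p with hp2 | hp2
    · have : h ^ 2 / p ≤ h ^ 2 / 2 := by gcongr
      have h3 : 0 ≤ h ^ 3 := by positivity
      nlinarith
    rcases le_total h (21 / 20) with h1 | h1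
    · have : h ^ 2 / p ≤ h ^ 2 / (2 - h) := by
        refine div_le_div_of_nonneg_left (sq_nonneg h) (by linarith) (by linarith)
      have e2 : 1 + h + h ^ 2 / (2 - h) = (2 + h) / (2 - h) := by
        have : 2 - h ≠ 0 := by linarith
        field_simp; ring
      have : (2 + h) / (2 - h) ≤ 6 / 5 * (1 + h + h ^ 2 / 2 + h ^ 3 / 6) := by
        rw [div_le_iff₀ (by linarith)]
        have h3 : h ^ 3 ≤ (21 / 20) ^ 3 := pow_le_pow_left₀ hh h1 3
        have h4 : h ^ 4 ≤ (21 / 20) ^ 4 := pow_le_pow_left₀ hh h1 4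
        nlinarith
      linarith
    · have : h ^ 2 / p ≤ h ^ 2 / (19 / 20) := by gcongr
      have : 0 ≤ 1 / 5 + 1 / 5 * h - 43 / 95 * h ^ 2 + 1 / 5 * h ^ 3 := by
        nlinarith [mul_nonneg (sub_nonneg.2 h1) (sq_nonneg (h - 5 / 4)), sq_nonneg (h - 5 / 4)]
      nlinarith
  · obtain ⟨k, rfl⟩ : ∃ k, h = -k := ⟨-h, by ring⟩
    have hk : 0 ≤ k := by linarith
    have h1 : (-k) ^ 2 / p ≤ (-k) ^ 2 / (2 + k) :=
      div_le_div_of_nonneg_left (sq_nonneg _) (by linarith) (by linarith)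
    have e2 : 1 + -k + (-k) ^ 2 / (2 + k) = (2 - k) / (2 + k) := by
      have : 2 + k ≠ 0 := by linarith
      field_simp; ring
    have h2 : (2 - k) / (2 + k) ≤ Real.exp (-k) := by
      rw [Real.exp_neg, ← one_div, div_le_div_iff₀ (by linarith) (Real.exp_pos _), one_mul]
      rcases le_total k 2 with hk2 | hk2
      · linarith [exp_mul_two_sub_le hk hk2]
      · nlinarith [Real.exp_pos k]
    have := Real.exp_pos (-k)
    linarith

variable {ι : Type*} [Fintype ι]

/-- A substitute for Jensen's inequality for `u ↦ exp (-θ / u)`, which is convex only for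
`u ≤ θ / 2`. -/
theorem exp_neg_div_sum_le {θ : ℝ} (hθ : 19 / 10 ≤ θ) {w d : ι → ℝ} (hw : ∀ j, 0 ≤ w j)
    (hw1 : ∑ j, w j ≤ 1) (hd : ∀ j, 1 / 2 ≤ d j) (ht : 0 < ∑ j, w j / d j) :
    Real.exp (-(θ / ∑ j, w j / d j)) ≤ 6 / 5 * ∑ j, w j * Real.exp (-(θ * d j)) := by
  set t := ∑ j, w j / d j with htdef
  have hθ0 : 0 < θ := by linarith
  -- The tangent is taken at `t` when `t` lies in the convex range u ≤ θ/2, and at the inflection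
  -- point u = θ/2 otherwise; beyond it the function is concave and stays below that tangent.
  set q := max (θ / t) 2 with hq
  have hq2 : 2 ≤ q := le_max_right _ _
  have step1 : Real.exp (-(θ / t)) ≤ Real.exp (-q) * (1 - q + q ^ 2 * (t / θ)) := by
    rcases le_total 2 (θ / t) with h | h
    · rw [hq, max_eq_left h]
      have : 1 - θ / t + (θ / t) ^ 2 * (t / θ) = 1 := by field_simp; ring
      rw [this, mul_one]
    · rw [hq, max_eq_right h]
      have hs : 0 < θ / t := by positivity
      have h2 := exp_mul_two_sub_le (k := 2 - θ / t) (by linarith) (by linarith)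
      have e : t / θ = 1 / (θ / t) := by field_simp
      rw [e]
      set s := θ / t
      have h3 : Real.exp (2 - s) ≤ 1 - 2 + 2 ^ 2 * (1 / s) := by
        have : 1 - 2 + 2 ^ 2 * (1 / s) = (4 - s) / s := by field_simp; ring
        rw [this, le_div_iff₀ hs]
        linarith
      calc Real.exp (-s) = Real.exp (-2) * Real.exp (2 - s) := by
            rw [← Real.exp_add]; ring_nf
        _ ≤ _ := by gcongr
  -- The constant term 1 - q is negative, so missing mass in the weights only helps.
  have step2 : 1 - q + q ^ 2 * (t / θ) ≤ ∑ j, w j * (1 - q + q ^ 2 / (θ * d j)) := by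
    have e : ∑ j, w j * (1 - q + q ^ 2 / (θ * d j)) = (1 - q) * ∑ j, w j + q ^ 2 * (t / θ) := by
      rw [htdef, Finset.mul_sum, Finset.sum_div, Finset.mul_sum, ← Finset.sum_add_distrib]
      refine Finset.sum_congr rfl fun j _ => ?_
      have : d j ≠ 0 := by linarith [hd j]
      field_simp
    rw [e]
    nlinarith
  calc _ ≤ Real.exp (-q) * (1 - q + q ^ 2 * (t / θ)) := step1
    _ ≤ Real.exp (-q) * ∑ j, w j * (1 - q + q ^ 2 / (θ * d j)) := by gcongr
    _ = ∑ j, w j * (Real.exp (-q) * (1 - q + q ^ 2 / (θ * d j))) := by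
        rw [Finset.mul_sum]; exact Finset.sum_congr rfl fun j _ => by ring
    _ ≤ ∑ j, w j * (6 / 5 * Real.exp (-(θ * d j))) := by
        refine Finset.sum_le_sum fun j _ => mul_le_mul_of_nonneg_left (tangent_le ?_ hq2) (hw j)
        nlinarith [hd j]
    _ = _ := by rw [Finset.mul_sum]; exact Finset.sum_congr rfl fun j _ => by ring

/-- The single term with the smallest `d` already suffices. This has constant 1 and no lower bound
on θ, as dimension one needs. -/
theorem exp_neg_div_sum_le_sum {θ : ℝ} (hθ : 0 ≤ θ) {w d : ι → ℝ} (hw : ∀ j, 0 ≤ w j)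
    (hw1 : ∑ j, w j ≤ 1) (hd : ∀ j, 0 < d j) (ht : 0 < ∑ j, w j / d j) :
    Real.exp (-(θ / ∑ j, w j / d j)) ≤ ∑ j, Real.exp (-(θ * d j)) := by
  obtain ⟨j₀, -, -⟩ := Finset.exists_ne_zero_of_sum_ne_zero ht.ne'
  obtain ⟨m, -, hm⟩ := Finset.exists_min_image Finset.univ d ⟨j₀, Finset.mem_univ _⟩
  refine le_trans ?_ (Finset.single_le_sum (f := fun j => Real.exp (-(θ * d j)))
    (fun j _ => (Real.exp_pos _).le) (Finset.mem_univ m))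
  have h1 : ∑ j, w j / d j ≤ 1 / d m := by
    calc _ ≤ ∑ j, w j / d m := by
          refine Finset.sum_le_sum fun j _ => ?_
          exact div_le_div_of_nonneg_left (hw j) (hd m) (hm j (Finset.mem_univ j))
      _ = (∑ j, w j) / d m := by rw [Finset.sum_div]
      _ ≤ _ := by have := (hd m).le; gcongr
  refine Real.exp_le_exp.2 (neg_le_neg ?_)
  rw [le_div_iff₀ ht]
  calc θ * d m * ∑ j, w j / d j ≤ θ * d m * (1 / d m) := by
        have := (hd m).le; gcongr
    _ = θ := by field_simp [(hd m).ne']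

/-- Jensen's inequality with the missing mass placed at 0. -/
theorem exp_sum_mul_le {w x : ι → ℝ} (hw : ∀ j, 0 ≤ w j) (hw1 : ∑ j, w j ≤ 1) :
    Real.exp (∑ j, w j * x j) ≤ 1 + ∑ j, w j * (Real.exp (x j) - 1) := by
  set X := ∑ j, w j * x j with hX
  set W := ∑ j, w j with hW
  have h1 : ∑ j, w j * (Real.exp X * (1 + x j - X)) ≤ ∑ j, w j * Real.exp (x j) := by
    refine Finset.sum_le_sum fun j _ => mul_le_mul_of_nonneg_left ?_ (hw j)
    calc _ ≤ Real.exp X * Real.exp (x j - X) := by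
          gcongr; linarith [Real.add_one_le_exp (x j - X)]
      _ = _ := by rw [← Real.exp_add]; ring_nf
  have h2 : ∑ j, w j * (Real.exp X * (1 + x j - X)) = Real.exp X * (W + X - X * W) := by
    have e : ∀ j, w j * (Real.exp X * (1 + x j - X))
        = Real.exp X * (w j + w j * x j - X * w j) := fun j => by ring
    simp only [e, ← Finset.mul_sum, Finset.sum_sub_distrib, Finset.sum_add_distrib]
    rfl
  have h3 : Real.exp X * (1 - X) ≤ 1 := by
    have := Real.add_one_le_exp (-X)
    calc _ ≤ Real.exp X * Real.exp (-X) := by gcongr; linarith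
      _ = 1 := by rw [← Real.exp_add]; simp
  have h4 : ∑ j, w j * (Real.exp (x j) - 1) = ∑ j, w j * Real.exp (x j) - W := by
    rw [hW, ← Finset.sum_sub_distrib]
    exact Finset.sum_congr rfl fun j _ => by ring
  rw [h4]
  nlinarith

theorem sum_exp_sum_mul_le {w : ι → ι → ℝ} {x : ι → ℝ} (hw : ∀ i j, 0 ≤ w i j)
    (hrow : ∀ i, ∑ j, w i j ≤ 1) (hcol : ∀ j, ∑ i, w i j ≤ 1) (hx : ∀ j, 0 ≤ x j) :
    ∑ i, Real.exp (∑ j, w i j * x j) ≤ ∑ j, Real.exp (x j) := by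
  calc _ ≤ ∑ i, (1 + ∑ j, w i j * (Real.exp (x j) - 1)) :=
        Finset.sum_le_sum fun i _ => exp_sum_mul_le (hw i) (hrow i)
    _ = ∑ j : ι, 1 + ∑ j, (∑ i, w i j) * (Real.exp (x j) - 1) := by
        rw [Finset.sum_add_distrib, Finset.sum_comm]
        simp only [Finset.sum_mul]
    _ ≤ ∑ j : ι, 1 + ∑ j, (Real.exp (x j) - 1) := by
        gcongr with j
        have : 0 ≤ Real.exp (x j) - 1 := by linarith [Real.add_one_le_exp (x j), hx j]
        nlinarith [hcol j]
    _ = _ := by rw [← Finset.sum_add_distrib]; exact Finset.sum_congr rfl fun j _ => by ring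

/-- The weights are unequal because `V`, the quadratic remainder, can only be amplified slightly
(5/4·17/16 < 4/3 later), whereas the linear part `U` tolerates the factor 5. -/
theorem exp_add_le_young (U V : ℝ) :
    Real.exp (U + V) ≤ 1 / 5 * Real.exp (5 * U) + 4 / 5 * Real.exp (5 / 4 * V) := by
  have := convexOn_exp.2 (Set.mem_univ (5 * U)) (Set.mem_univ (5 / 4 * V))
    (show (0 : ℝ) ≤ 1 / 5 by norm_num) (show (0 : ℝ) ≤ 4 / 5 by norm_num) (by norm_num)
  simp only [smul_eq_mul] at this
  refine le_trans (le_of_eq ?_) this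
  ring_nf

theorem log_three_mul_ge {p c : ℕ} (hc : 0 < c) (hcp : c ≤ p) :
    Real.log (3 * c) ≤ Real.log (3 * p) := by
  have : (c : ℝ) ≤ p := by exact_mod_cast hcp
  have : (0 : ℝ) < c := by exact_mod_cast hc
  exact Real.log_le_log (by positivity) (by linarith)

theorem exp_tail_le_half {p : ℕ} (hp : 2 ≤ p) {L n : ℝ} (hL : Real.log (3 * p) ≤ L)
    (hn : 28 / 3 * L ≤ n) :
    Real.exp (-(n * ((1 - Real.log 2) / 2))) ≤ 1 / 2 * Real.exp (-L) := by
  have h2 := Real.log_two_lt_d9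
  have h2' := Real.log_two_gt_d9
  have h3 := Real.log_three_gt_d9
  have h6 : Real.log 3 + Real.log 2 ≤ L := by
    rw [← Real.log_mul (by norm_num) (by norm_num)]
    exact (log_three_mul_ge (by norm_num) hp).trans hL
  have : (1 / 2 : ℝ) = Real.exp (-Real.log 2) := by
    rw [Real.exp_neg, Real.exp_log (by norm_num)]; norm_num
  rw [this, ← Real.exp_add]
  refine Real.exp_le_exp.2 ?_
  have : 28 / 3 * L * ((1 - Real.log 2) / 2) ≤ n * ((1 - Real.log 2) / 2) := by
    refine mul_le_mul_of_nonneg_right hn ?_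
    linarith
  nlinarith

theorem exp_tail_le_one {L n : ℝ} (hL : 0 ≤ L) (hn : 28 / 3 * L ≤ n) :
    Real.exp (-(n * ((1 - Real.log 2) / 2))) ≤ Real.exp (-L) := by
  have h2 := Real.log_two_lt_d9
  refine Real.exp_le_exp.2 ?_
  have : 28 / 3 * L * ((1 - Real.log 2) / 2) ≤ n * ((1 - Real.log 2) / 2) := by
    refine mul_le_mul_of_nonneg_right hn ?_
    linarith
  nlinarith

/-- The surplus in the exponent must reach log 4. For small `p` the term 16/(17p) supplies it, for
large `p` the bound L ≥ log(3p) does; hence the ranges 1, 2–3, 4–8 and at least 9. -/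
theorem exp_tail_le_quarter {p : ℕ} (hp : 0 < p) {L n : ℝ} (hL : Real.log (3 * p) ≤ L)
    (hn : 28 / 3 * L * (1 + 16 / (17 * p)) ≤ n) :
    Real.exp (-(n * ((1 - Real.log 2) / 2))) ≤ 1 / 4 * Real.exp (-L) := by
  have h2 := Real.log_two_lt_d9
  have h2' := Real.log_two_gt_d9
  have h3 := Real.log_three_gt_d9
  have hp0 : (0 : ℝ) < p := by exact_mod_cast hp
  have h4 : (1 / 4 : ℝ) = Real.exp (-(2 * Real.log 2)) := by
    rw [two_mul, neg_add, Real.exp_add, Real.exp_neg, Real.exp_log (by norm_num)]; norm_num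
  have hL1 : Real.log 3 ≤ L := by
    have := (log_three_mul_ge one_pos hp).trans hL
    simpa using this
  rw [h4, ← Real.exp_add]
  refine Real.exp_le_exp.2 ?_
  have h5 : 28 / 3 * L * (1 + 16 / (17 * p)) * 0.1534 ≤ n * ((1 - Real.log 2) / 2) := by
    have : 0 ≤ 28 / 3 * L * (1 + 16 / (17 * p)) := by
      have : 0 ≤ L := by linarith
      positivity
    exact mul_le_mul hn (by linarith) (by norm_num) (this.trans hn)
  have key : 1.3863 ≤ L * (0.4317 + 1.347 * (1 / p)) := by
    rcases Nat.lt_or_ge p 2 with h | h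
    · have : p = 1 := by omega
      subst this
      norm_num
      linarith
    rcases Nat.lt_or_ge p 4 with h' | h'
    · have h6 : Real.log 3 + Real.log 2 ≤ L := by
        rw [← Real.log_mul (by norm_num) (by norm_num)]
        exact (log_three_mul_ge (by norm_num) h).trans hL
      have : (1 / 3 : ℝ) ≤ 1 / p := by
        have : (p : ℝ) ≤ 3 := by exact_mod_cast Nat.lt_succ_iff.1 h'
        gcongr
      nlinarith
    rcases Nat.lt_or_ge p 9 with h'' | h''
    · have h6 : Real.log 3 + 2 * Real.log 2 ≤ L := by
        have e : Real.log 3 + 2 * Real.log 2 = Real.log (3 * (4 : ℕ)) := by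
          rw [Real.log_mul (by norm_num) (by norm_num), show ((4 : ℕ) : ℝ) = 2 ^ 2 by norm_num,
            Real.log_pow]
          push_cast; ring
        rw [e]
        exact (log_three_mul_ge (by norm_num) h').trans hL
      have : (1 / 8 : ℝ) ≤ 1 / p := by
        have : (p : ℝ) ≤ 8 := by exact_mod_cast Nat.lt_succ_iff.1 h''
        gcongr
      nlinarith
    · have h6 : 3 * Real.log 3 ≤ L := by
        have e : 3 * Real.log 3 = Real.log (3 * (9 : ℕ)) := by
          rw [show (3 * (9 : ℕ) : ℝ) = 3 ^ 3 by norm_num, Real.log_pow]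
          push_cast; ring
        rw [e]
        exact (log_three_mul_ge (by norm_num) h'').trans hL
      have : (0 : ℝ) < 1 / p := by positivity
      nlinarith
  have e : 28 / 3 * L * (1 + 16 / (17 * p)) = L * (28 / 3 + 448 / 51 * (1 / p)) := by
    field_simp
    ring
  rw [e] at h5
  have : 0 ≤ L * (1 / p) := by
    have : 0 ≤ L := by linarith
    positivity
  nlinarith

end Scalar

/-! ### Deterministic bounds through the spectrum of the whitened Gram matrix. -/

section Spectral

set_option linter.unusedSectionVars false

open Matrix NormedSpace

variable {ι : Type*} [Fintype ι] [DecidableEq ι]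

theorem dotProduct_self_le_one {y : ι → ι → ℝ}
    (hy : ∀ v, ∑ i, (y i ⬝ᵥ v) ^ 2 ≤ v ⬝ᵥ v) (i : ι) : y i ⬝ᵥ y i ≤ 1 := by
  have h1 : (y i ⬝ᵥ y i) ^ 2 ≤ y i ⬝ᵥ y i :=
    (Finset.single_le_sum (f := fun k => (y k ⬝ᵥ y i) ^ 2) (fun k _ => sq_nonneg _)
      (Finset.mem_univ i)).trans (hy (y i))
  nlinarith

/-- The spectral data of a symmetric matrix whose eigenvalues are forced to be at least `1 / 2`
by a bound on a trace exponential. -/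
theorem exists_spectral_weights {G : Matrix ι ι ℝ} (hG : G.IsSymm) {y : ι → ι → ℝ}
    (hy : ∀ v, ∑ i, (y i ⬝ᵥ v) ^ 2 ≤ v ⬝ᵥ v) (hy0 : ∀ i, 0 < y i ⬝ᵥ y i) {s₀ : ℝ} (hs₀ : 0 < s₀)
    (hT : (exp (-s₀ • G)).trace ≤ Real.exp (-s₀ / 2)) :
    IsUnit G ∧ ∃ (w : ι → ι → ℝ) (d : ι → ℝ), (∀ j, 1 / 2 ≤ d j) ∧ (∀ i j, 0 ≤ w i j) ∧
      (∀ i, ∑ j, w i j = y i ⬝ᵥ y i) ∧ (∀ j, ∑ i, w i j ≤ 1) ∧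
      (∀ i, 0 < ∑ j, w i j / d j) ∧ (∀ i, y i ⬝ᵥ (G⁻¹ *ᵥ y i) = ∑ j, w i j / d j) ∧
      (∀ i, y i ⬝ᵥ (G *ᵥ y i) = ∑ j, d j * w i j) ∧
      ∀ s : ℝ, (exp (-s • G)).trace = ∑ j, Real.exp (-s * d j) := by
  obtain ⟨V, d, h1, h2, rfl⟩ := exists_orthogonal_diagonalization hG
  have htr : ∀ s : ℝ, (exp (-s • (V * diagonal d * Vᵀ))).trace = ∑ j, Real.exp (-s * d j) := by
    intro s
    rw [exp_smul_of_diagonalization h1, trace_conj_diagonal h2]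
  have hd : ∀ j, 1 / 2 ≤ d j := by
    intro j
    rw [htr] at hT
    have := (Finset.single_le_sum (f := fun j => Real.exp (-s₀ * d j))
      (fun j _ => (Real.exp_pos _).le) (Finset.mem_univ j)).trans hT
    have := Real.exp_le_exp.1 this
    nlinarith
  have hd0 : ∀ j, d j ≠ 0 := fun j => by linarith [hd j]
  have hmul : V * diagonal d * Vᵀ * (V * diagonal (fun j => 1 / d j) * Vᵀ) = 1 := by
    calc _ = V * (diagonal d * (Vᵀ * V) * diagonal (fun j => 1 / d j)) * Vᵀ := by
          simp only [Matrix.mul_assoc]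
      _ = 1 := by
          rw [h2, Matrix.mul_one, diagonal_mul_diagonal]
          simp only [mul_one_div_cancel (hd0 _)]
          rw [diagonal_one, Matrix.mul_one, h1]
  have hinv : (V * diagonal d * Vᵀ)⁻¹ = V * diagonal (fun j => 1 / d j) * Vᵀ :=
    inv_eq_right_inv hmul
  have hsum : ∀ i, ∑ j, (Vᵀ *ᵥ y i) j ^ 2 = y i ⬝ᵥ y i := fun i => sum_sq_orthogonal_mulVec h1 _
  refine ⟨IsUnit.of_mul_eq_one _ hmul, fun i j => (Vᵀ *ᵥ y i) j ^ 2, d, hd,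
    fun i j => sq_nonneg _, hsum, ?_, ?_, ?_, ?_, htr⟩
  · intro j
    have h := hy fun k => V k j
    have e : ∀ i, (Vᵀ *ᵥ y i) j = y i ⬝ᵥ fun k => V k j := fun i => dotProduct_comm _ _
    have e2 : (fun k => V k j) ⬝ᵥ (fun k => V k j) = 1 := by
      have := congrFun (congrFun h2 j) j
      rw [one_apply_eq] at this
      exact this
    simp only [e]
    rwa [e2] at h
  · intro i
    refine lt_of_le_of_ne (Finset.sum_nonneg fun j _ =>
      div_nonneg (sq_nonneg _) (by linarith [hd j])) fun h => ?_
    have h0 := (Finset.sum_eq_zero_iff_of_nonneg fun j _ =>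
      div_nonneg (sq_nonneg _) (by linarith [hd j])).1 h.symm
    refine (hy0 i).ne' ((hsum i).symm.trans (Finset.sum_eq_zero fun j hj => ?_))
    have := h0 j hj
    rw [div_eq_zero_iff] at this
    exact this.resolve_right (hd0 j)
  · intro i
    rw [hinv, dotProduct_conj_diagonal_mulVec]
    exact Finset.sum_congr rfl fun j _ => by ring
  · intro i
    exact dotProduct_conj_diagonal_mulVec _ _ _

section Deterministic

variable {G : Matrix ι ι ℝ} (hG : G.IsSymm) {y : ι → ι → ℝ}
    (hy : ∀ v, ∑ i, (y i ⬝ᵥ v) ^ 2 ≤ v ⬝ᵥ v) (hy0 : ∀ i, 0 < y i ⬝ᵥ y i) {s₀ : ℝ} (hs₀ : 0 < s₀)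
    (hT : (exp (-s₀ • G)).trace ≤ Real.exp (-s₀ / 2))

include hG hy hy0 hs₀ hT

/-- The squared coordinates of the `y i` in an eigenbasis have row and column sums at most 1, so the
scalar inequality for each `i` can be summed over `i` without losing a factor of the dimension. -/
theorem sum_exp_neg_div_le {θ : ℝ} (hθ : 19 / 10 ≤ θ) :
    ∑ i, Real.exp (-(θ / (y i ⬝ᵥ (G⁻¹ *ᵥ y i)))) ≤ 6 / 5 * (exp (-θ • G)).trace := by
  obtain ⟨-, w, d, hd, hw, hrow, hcol, hpos, hinv, -, htr⟩ :=
    exists_spectral_weights hG hy hy0 hs₀ hT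
  have h1 : ∀ i, ∑ j, w i j ≤ 1 := fun i => (hrow i).trans_le (dotProduct_self_le_one hy i)
  calc _ ≤ ∑ i, 6 / 5 * ∑ j, w i j * Real.exp (-(θ * d j)) := by
        refine Finset.sum_le_sum fun i _ => ?_
        rw [hinv]
        exact exp_neg_div_sum_le hθ (hw i) (h1 i) hd (hpos i)
    _ = 6 / 5 * ∑ j, (∑ i, w i j) * Real.exp (-(θ * d j)) := by
        rw [← Finset.mul_sum, Finset.sum_comm]
        simp only [Finset.sum_mul]
    _ ≤ 6 / 5 * ∑ j, Real.exp (-θ * d j) := by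
        gcongr with j
        rw [neg_mul]
        exact mul_le_of_le_one_left (Real.exp_pos _).le (hcol j)
    _ = _ := by rw [htr]

theorem exp_neg_div_le_trace {θ : ℝ} (hθ : 0 ≤ θ) (i : ι) :
    Real.exp (-(θ / (y i ⬝ᵥ (G⁻¹ *ᵥ y i)))) ≤ (exp (-θ • G)).trace := by
  obtain ⟨-, w, d, hd, hw, hrow, hcol, hpos, hinv, -, htr⟩ :=
    exists_spectral_weights hG hy hy0 hs₀ hT
  rw [hinv, htr]
  simp only [neg_mul]
  exact exp_neg_div_sum_le_sum hθ (hw i) ((hrow i).trans_le (dotProduct_self_le_one hy i))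
    (fun j => by linarith [hd j]) (hpos i)

/-- From 1/d = 2 - d + (1-d)²/d, the form yᵀG⁻¹y is affine in G up to a weighted sum of (1-d)²/d.
Young's inequality separates the parts, and substochasticity passes from the weights to the
eigenvalues. -/
theorem sum_exp_neg_div_le_mix {κ L n : ℝ} (hκ : 0 ≤ κ) (hL : 0 ≤ L) (hn : 10 ≤ n)
    (hκL : 5 / 4 * (κ * L) ≤ n / 7) :
    ENNReal.ofReal (∑ i, Real.exp (-(κ * L / (y i ⬝ᵥ (G⁻¹ *ᵥ y i))))) ≤
      ENNReal.ofReal (Real.exp (-L)) * (ENNReal.ofReal (1 / 5) * ∑ i, ENNReal.ofReal (Real.exp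
        (5 * (L * (1 - 2 * κ + 2 * κ * (y i ⬝ᵥ y i) - κ * (y i ⬝ᵥ (G *ᵥ y i))))))
        + ENNReal.ofReal (4 / 5) * mix n fun s => (exp (-s • G)).trace) := by
  obtain ⟨-, w, d, hd, hw, hrow, hcol, hpos, hinv, hquad, htr⟩ :=
    exists_spectral_weights hG hy hy0 hs₀ hT
  have hd0 : ∀ j, 0 < d j := fun j => by linarith [hd j]
  simp only [htr]
  set f : ι → ℝ := fun j => (1 - d j) ^ 2 / d j with hf
  have hf0 : ∀ j, 0 ≤ f j := fun j => div_nonneg (sq_nonneg _) (hd0 j).le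
  set U : ι → ℝ := fun i =>
    L * (1 - 2 * κ + 2 * κ * (y i ⬝ᵥ y i) - κ * (y i ⬝ᵥ (G *ᵥ y i))) with hU
  have hmain : ∀ i, Real.exp (-(κ * L / (y i ⬝ᵥ (G⁻¹ *ᵥ y i)))) ≤ Real.exp (-L) *
      (1 / 5 * Real.exp (5 * U i) + 4 / 5 * Real.exp (∑ j, w i j * (n / 7 * f j))) := by
    intro i
    have ht := hpos i
    rw [hinv]
    set t := ∑ j, w i j / d j with htd
    have et : t = 2 * (y i ⬝ᵥ y i) - y i ⬝ᵥ (G *ᵥ y i) + ∑ j, w i j * f j := by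
      rw [htd, hquad, ← hrow, Finset.mul_sum, ← Finset.sum_sub_distrib, ← Finset.sum_add_distrib]
      refine Finset.sum_congr rfl fun j _ => ?_
      have := (hd0 j).ne'
      rw [hf]
      field_simp
      ring
    have h1 : 2 - t ≤ 1 / t := by
      rw [le_div_iff₀ ht]; nlinarith [sq_nonneg (t - 1)]
    have hκL0 : 0 ≤ κ * L := mul_nonneg hκ hL
    have h2 : -(κ * L / t) ≤ -L + (U i + κ * L * ∑ j, w i j * f j) := by
      have := mul_le_mul_of_nonneg_left h1 hκL0
      rw [mul_one_div] at this
      have e : -L + (U i + κ * L * ∑ j, w i j * f j) = -(κ * L * (2 - t)) := by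
        rw [et, hU]; ring
      rw [e]
      linarith
    have h3 : 5 / 4 * (κ * L * ∑ j, w i j * f j) ≤ ∑ j, w i j * (n / 7 * f j) := by
      rw [Finset.mul_sum, Finset.mul_sum]
      refine Finset.sum_le_sum fun j _ => ?_
      have := mul_le_mul_of_nonneg_right hκL (mul_nonneg (hw i j) (hf0 j))
      linarith
    calc _ ≤ Real.exp (-L) * Real.exp (U i + κ * L * ∑ j, w i j * f j) := by
          rw [← Real.exp_add]; exact Real.exp_le_exp.2 h2
      _ ≤ Real.exp (-L) * (1 / 5 * Real.exp (5 * U i)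
            + 4 / 5 * Real.exp (5 / 4 * (κ * L * ∑ j, w i j * f j))) := by
          gcongr
          exact exp_add_le_young _ _
      _ ≤ _ := by gcongr
  have hsum : ∑ i, Real.exp (-(κ * L / (y i ⬝ᵥ (G⁻¹ *ᵥ y i)))) ≤ Real.exp (-L) *
      (1 / 5 * ∑ i, Real.exp (5 * U i) + 4 / 5 * ∑ j, Real.exp (n / 7 * f j)) := by
    refine (Finset.sum_le_sum fun i _ => hmain i).trans ?_
    rw [← Finset.mul_sum, Finset.sum_add_distrib, ← Finset.mul_sum, ← Finset.mul_sum]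
    have := sum_exp_sum_mul_le (x := fun j => n / 7 * f j) hw
      (fun i => (hrow i).trans_le (dotProduct_self_le_one hy i)) hcol
      fun j => mul_nonneg (by linarith) (hf0 j)
    exact mul_le_mul_of_nonneg_left (by linarith) (Real.exp_pos _).le
  refine (ENNReal.ofReal_le_ofReal hsum).trans ?_
  have hS : 0 ≤ ∑ i, Real.exp (5 * U i) := Finset.sum_nonneg fun i _ => (Real.exp_pos _).le
  have hS' : 0 ≤ ∑ j, Real.exp (n / 7 * f j) := Finset.sum_nonneg fun i _ => (Real.exp_pos _).le
  rw [ENNReal.ofReal_mul (Real.exp_pos _).le, ENNReal.ofReal_add (by positivity) (by positivity),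
    ENNReal.ofReal_mul (by norm_num), ENNReal.ofReal_mul (by norm_num),
    ENNReal.ofReal_sum_of_nonneg fun i _ => (Real.exp_pos _).le]
  gcongr
  exact sum_exp_le_mix hn hd

end Deterministic

end Spectral

/-! ### Bernstein estimate for the linear part. -/

section Expectation

set_option linter.unusedSectionVars false

open Matrix NormedSpace

variable {ι : Type*} [Fintype ι] [DecidableEq ι]
variable {Ω : Type*} [MeasurableSpace Ω] {P : Measure Ω} [IsProbabilityMeasure P]

theorem dotProduct_gram_mulVec {κ : Type*} (s : Finset κ) (x : κ → ι → ℝ) (y : ι → ℝ) :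
    y ⬝ᵥ (gram s x *ᵥ y) = ∑ n ∈ s, (y ⬝ᵥ x n) ^ 2 := by
  rw [gram, sum_mulVec, dotProduct_sum]
  refine Finset.sum_congr rfl fun n _ => ?_
  rw [vecMulVec_mulVec, dotProduct_smul, dotProduct_comm (x n) y]
  simp [sq]

theorem quadLin_vecMulVec (a u v : ι → ℝ) :
    quadLin a (vecMulVec u v) = (u ⬝ᵥ a) * (v ⬝ᵥ a) := by
  rw [quadLin_apply, vecMulVec_mulVec, dotProduct_smul, dotProduct_comm a u]
  simp

theorem integrable_dotProduct_mul_dotProduct {g : Ω → ι → ℝ} (hg : Measurable g) {B : ℝ}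
    (hB : ∀ᵐ ω ∂P, g ω ⬝ᵥ g ω ≤ B) (u v : ι → ℝ) :
    Integrable (fun ω => (u ⬝ᵥ g ω) * (v ⬝ᵥ g ω)) P := by
  simpa only [quadLin_vecMulVec] using integrable_quadLin hg hB (vecMulVec u v)

theorem integral_dotProduct_mul_dotProduct {g : Ω → ι → ℝ} (hg : Measurable g) {B : ℝ}
    (hB : ∀ᵐ ω ∂P, g ω ⬝ᵥ g ω ≤ B)
    (hcov : ∀ k l, ∫ ω, g ω k * g ω l ∂P = (1 : Matrix ι ι ℝ) k l) (u v : ι → ℝ) :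
    ∫ ω, (u ⬝ᵥ g ω) * (v ⬝ᵥ g ω) ∂P = u ⬝ᵥ v := by
  have := integral_quadLin hg hB hcov (vecMulVec u v)
  simpa only [quadLin_vecMulVec, trace_vecMulVec] using this

theorem dotProduct_sq_le (u v : ι → ℝ) : (u ⬝ᵥ v) ^ 2 ≤ (u ⬝ᵥ u) * (v ⬝ᵥ v) := by
  have := Finset.sum_mul_sq_le_sq_mul_sq Finset.univ u v
  simpa only [dotProduct, sq] using this

/-- With α = z·g and Z = y·g the right side has mean (2p+3)κ(κ - 2 + |y|²), since z·y = 1. This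
variance proxy vanishes when κ = |y|² = 1, which a bound by the range alone would miss. -/
theorem sub_sq_sq_le {p κ α Z : ℝ} (hp : 0 ≤ p) (hα : α ^ 2 ≤ κ) (hZ : Z ^ 2 ≤ p * κ) :
    (κ - Z ^ 2) ^ 2 ≤ (2 * p + 3) * κ * (κ - 2 * (α * Z) + Z ^ 2) := by
  have hκ : 0 ≤ κ := (sq_nonneg α).trans hα
  have h1 : (α ^ 2 - Z ^ 2) ^ 2 ≤ 2 * (1 + p) * κ * (α - Z) ^ 2 := by
    have : (α + Z) ^ 2 ≤ 2 * (1 + p) * κ := by nlinarith [sq_nonneg (α - Z)]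
    calc _ = (α + Z) ^ 2 * (α - Z) ^ 2 := by ring
      _ ≤ _ := mul_le_mul_of_nonneg_right this (sq_nonneg _)
  have h2 : (κ - α ^ 2) ^ 2 ≤ κ * (κ - α ^ 2) := by
    rw [sq]; exact mul_le_mul_of_nonneg_right (by nlinarith) (by linarith)
  have h3 : (κ - Z ^ 2) ^ 2 * (2 * p + 2) ≤
      (2 * p + 3) * ((2 * p + 2) * (κ - α ^ 2) ^ 2 + (α ^ 2 - Z ^ 2) ^ 2) := by
    nlinarith [sq_nonneg ((2 * p + 2) * (κ - α ^ 2) - (α ^ 2 - Z ^ 2))]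
  have h4 : (2 * p + 3) * ((2 * p + 2) * (κ - α ^ 2) ^ 2 + (α ^ 2 - Z ^ 2) ^ 2) ≤
      (2 * p + 3) * κ * (κ - 2 * (α * Z) + Z ^ 2) * (2 * p + 2) := by
    have := mul_le_mul_of_nonneg_left h2 (show 0 ≤ (2 * p + 3) * (2 * p + 2) by positivity)
    have := mul_le_mul_of_nonneg_left h1 (show 0 ≤ 2 * p + 3 by positivity)
    nlinarith
  exact le_of_mul_le_mul_right (h3.trans h4) (by positivity)

theorem mgf_sub_sq_le {g : Ω → ι → ℝ} (hg : Measurable g) {κ : ℝ} 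
    (hB : ∀ᵐ ω ∂P, g ω ⬝ᵥ g ω ≤ Fintype.card ι * κ)
    (hcov : ∀ k l, ∫ ω, g ω k * g ω l ∂P = (1 : Matrix ι ι ℝ) k l) {y z : ι → ℝ}
    (hy : y ⬝ᵥ y ≤ 1) (hzy : z ⬝ᵥ y = 1) (hz : ∀ᵐ ω ∂P, (z ⬝ᵥ g ω) ^ 2 ≤ κ)
    {c : ℝ} (hc : 0 ≤ c) (hcκ : c * κ ≤ 3 / 10) :
    mgf (fun ω => κ - (y ⬝ᵥ g ω) ^ 2) P c ≤ Real.exp (c * (κ - y ⬝ᵥ y)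
      + 5 / 9 * c ^ 2 * ((2 * Fintype.card ι + 3) * κ * (κ - 2 + y ⬝ᵥ y))) := by
  set p : ℝ := (Fintype.card ι : ℝ) with hp
  have hi := integrable_dotProduct_mul_dotProduct hg hB
  have hI := integral_dotProduct_mul_dotProduct hg hB hcov
  have hle : ∀ᵐ ω ∂P, Real.exp (c * (κ - (y ⬝ᵥ g ω) ^ 2)) ≤
      (1 + c * κ + 5 / 9 * c ^ 2 * ((2 * p + 3) * κ * κ))
        + (5 / 9 * c ^ 2 * ((2 * p + 3) * κ) - c) * ((y ⬝ᵥ g ω) * (y ⬝ᵥ g ω))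
        - 2 * (5 / 9 * c ^ 2 * ((2 * p + 3) * κ)) * ((z ⬝ᵥ g ω) * (y ⬝ᵥ g ω)) := by
    filter_upwards [hB, hz] with ω h1 h2
    have h3 : (y ⬝ᵥ g ω) ^ 2 ≤ p * κ := by
      refine (dotProduct_sq_le _ _).trans (le_trans ?_ h1)
      refine mul_le_of_le_one_left ?_ hy
      exact Finset.sum_nonneg fun j _ => mul_self_nonneg _
    have h4 := sub_sq_sq_le (Nat.cast_nonneg _) h2 h3
    have h5 : c * (κ - (y ⬝ᵥ g ω) ^ 2) ≤ 3 / 10 := by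
      nlinarith [mul_nonneg hc (sq_nonneg (y ⬝ᵥ g ω))]
    have h6 := exp_le_quadratic h5
    have h7 := mul_le_mul_of_nonneg_left h4 (show 0 ≤ 5 / 9 * c ^ 2 by positivity)
    rw [mul_pow] at h6
    linarith
  have hint : Integrable (fun ω => (1 + c * κ + 5 / 9 * c ^ 2 * ((2 * p + 3) * κ * κ))
        + (5 / 9 * c ^ 2 * ((2 * p + 3) * κ) - c) * ((y ⬝ᵥ g ω) * (y ⬝ᵥ g ω))
        - 2 * (5 / 9 * c ^ 2 * ((2 * p + 3) * κ)) * ((z ⬝ᵥ g ω) * (y ⬝ᵥ g ω))) P :=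
    ((integrable_const _).add ((hi y y).const_mul _)).sub ((hi z y).const_mul _)
  have hint' : Integrable (fun ω => (1 + c * κ + 5 / 9 * c ^ 2 * ((2 * p + 3) * κ * κ))
        + (5 / 9 * c ^ 2 * ((2 * p + 3) * κ) - c) * ((y ⬝ᵥ g ω) * (y ⬝ᵥ g ω))) P :=
    (integrable_const _).add ((hi y y).const_mul _)
  calc _ ≤ _ := integral_mono_of_nonneg
        (Filter.Eventually.of_forall fun ω => (Real.exp_pos _).le) hint hle
    _ = 1 + (c * (κ - y ⬝ᵥ y)
      + 5 / 9 * c ^ 2 * ((2 * p + 3) * κ * (κ - 2 + y ⬝ᵥ y))) := by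
        rw [integral_sub hint' ((hi z y).const_mul _),
          integral_add (integrable_const _) ((hi y y).const_mul _), integral_const_mul,
          integral_const_mul, hI, hI, hzy]
        simp only [integral_const, probReal_univ, one_smul]
        ring
    _ ≤ _ := by rw [add_comm]; exact Real.add_one_le_exp _

/-- Independence reduces the exponent to N copies of the single-vector estimate at c = 5Lκ/N, and
the drift 1 - 2κ + κ|y|² absorbs the variance term. -/
theorem lintegral_exp_quadratic_form_le {g : ℕ → Ω → ι → ℝ} (hg : ∀ n, Measurable (g n))
    (hind : iIndepFun g P) {κ : ℝ} (hκ : 1 ≤ κ) (hκ' : κ ≤ 17 / 16)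
    (hB : ∀ n, ∀ᵐ ω ∂P, g n ω ⬝ᵥ g n ω ≤ Fintype.card ι * κ)
    (hcov : ∀ n k l, ∫ ω, g n ω k * g n ω l ∂P = (1 : Matrix ι ι ℝ) k l)
    (hp : 1 ≤ Fintype.card ι) {y z : ι → ℝ}
    (hy : y ⬝ᵥ y ≤ 1) (hzy : z ⬝ᵥ y = 1) (hz : ∀ n, ∀ᵐ ω ∂P, (z ⬝ᵥ g n ω) ^ 2 ≤ κ)
    {L : ℝ} (hL : 0 < L) {N : ℕ} (hN : 28 / 3 * (Fintype.card ι * κ + 1) * L ≤ N) :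
    ∫⁻ ω, ENNReal.ofReal (Real.exp (5 * (L * (1 - 2 * κ + 2 * κ * (y ⬝ᵥ y) - κ *
      (y ⬝ᵥ (((N : ℝ)⁻¹ • gram (Finset.range N) fun n => g n ω) *ᵥ y)))))) ∂P ≤ 1 := by
  set p : ℝ := (Fintype.card ι : ℝ) with hpdef
  have hp1 : 1 ≤ p := by rw [hpdef]; exact_mod_cast hp
  have hN0 : (0 : ℝ) < N := lt_of_lt_of_le (by positivity) hN
  set c := 5 * L * κ / N with hc
  have hc0 : 0 ≤ c := by positivity
  have hc1 : c ≤ 15 * κ / (28 * (p + 1)) := by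
    rw [hc, div_le_div_iff₀ hN0 (by positivity)]
    have : 28 / 3 * (p + 1) * L ≤ N := by
      refine le_trans ?_ hN
      gcongr
      nlinarith
    nlinarith [mul_le_mul_of_nonneg_left this (show 0 ≤ 15 * κ by linarith)]
  have hcκ : c * κ ≤ 3 / 10 := by
    rw [hc, div_mul_eq_mul_div, div_le_iff₀ hN0]
    have h1 : 28 / 3 * (κ + 1) * L ≤ N := by
      refine le_trans ?_ hN
      gcongr
      nlinarith
    have h2 : 5 * κ ^ 2 ≤ 14 / 5 * (κ + 1) := by nlinarith
    nlinarith [mul_le_mul_of_nonneg_right h2 hL.le]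
  let X : ℕ → Ω → ℝ := fun n ω => κ - (y ⬝ᵥ g n ω) ^ 2
  have hXm : ∀ n, Measurable (X n) := fun n => by
    have : Measurable fun ω => y ⬝ᵥ g n ω := by
      unfold dotProduct
      have := hg n
      fun_prop
    exact (this.pow_const 2).const_sub κ
  have hXi : iIndepFun X P := by
    refine hind.comp (fun _ x => κ - (y ⬝ᵥ x) ^ 2) fun _ => ?_
    unfold dotProduct
    fun_prop
  have hmgf := hXi.mgf_sum (t := c) hXm (Finset.range N)
  have hXle : ∀ n ω, X n ω ≤ κ := fun n ω => by
    have := sq_nonneg (y ⬝ᵥ g n ω)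
    simp only [X]; linarith
  set S : Ω → ℝ := fun ω => (∑ n ∈ Finset.range N, X n) ω with hS
  have hSle : ∀ ω, S ω ≤ N * κ := fun ω => by
    rw [hS]
    simp only [Finset.sum_apply]
    refine (Finset.sum_le_sum fun n _ => hXle n ω).trans ?_
    simp
  have hSm : Measurable S := by
    have : S = fun ω => ∑ n ∈ Finset.range N, X n ω := by funext ω; simp [hS]
    rw [this]
    exact Finset.measurable_fun_sum _ fun n _ => hXm n
  set E := c * (κ - y ⬝ᵥ y) + 5 / 9 * c ^ 2 * ((2 * p + 3) * κ * (κ - 2 + y ⬝ᵥ y)) with hE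
  have hSmgf : ∫ ω, Real.exp (c * S ω) ∂P ≤ Real.exp (N * E) := by
    change mgf (∑ n ∈ Finset.range N, X n) P c ≤ _
    rw [hmgf]
    refine (Finset.prod_le_prod (fun _ _ => mgf_nonneg) fun n _ =>
      mgf_sub_sq_le (hg n) (hB n) (hcov n) hy hzy (hz n) hc0 hcκ).trans ?_
    rw [Finset.prod_const, Finset.card_range, ← Real.exp_nat_mul]
  have hint : Integrable (fun ω => Real.exp (c * S ω)) P := by
    refine Integrable.of_bound (hSm.const_mul c).exp.aestronglyMeasurable
      (Real.exp (c * (N * κ))) (Filter.Eventually.of_forall fun ω => ?_)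
    rw [Real.norm_eq_abs, abs_of_pos (Real.exp_pos _)]
    have := hSle ω
    gcongr
  set D := 5 * L * (1 - 2 * κ + 2 * κ * (y ⬝ᵥ y) - κ ^ 2) with hD
  have e : ∀ ω, Real.exp (5 * (L * (1 - 2 * κ + 2 * κ * (y ⬝ᵥ y) - κ *
      (y ⬝ᵥ (((N : ℝ)⁻¹ • gram (Finset.range N) fun n => g n ω) *ᵥ y)))))
      = Real.exp D * Real.exp (c * S ω) := by
    intro ω
    rw [← Real.exp_add, smul_mulVec, dotProduct_smul, dotProduct_gram_mulVec, hS]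
    simp only [Finset.sum_apply, X, Finset.sum_sub_distrib, Finset.sum_const, Finset.card_range,
      smul_eq_mul, nsmul_eq_mul]
    congr 1
    rw [hD, hc]
    field_simp
    ring
  simp only [e]
  rw [← ofReal_integral_eq_lintegral_ofReal (hint.const_mul _)
    (Filter.Eventually.of_forall fun ω => by positivity), integral_const_mul]
  refine ENNReal.ofReal_le_one.2 ?_
  calc _ ≤ Real.exp D * Real.exp (N * E) := by gcongr
    _ ≤ 1 := by
      rw [← Real.exp_add, ← Real.exp_zero]
      refine Real.exp_le_exp.2 ?_
      -- Cauchy–Schwarz for z·y = 1, with |z|² ≤ κ read off from isotropy. It makes the variance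
      -- proxy nonnegative.
      have hyy : 1 ≤ κ * (y ⬝ᵥ y) := by
        have h1 : z ⬝ᵥ z ≤ κ := by
          rw [← integral_dotProduct_mul_dotProduct (hg 0) (hB 0) (hcov 0)]
          refine (integral_mono_ae (integrable_dotProduct_mul_dotProduct (hg 0) (hB 0) z z)
            (integrable_const κ) ?_).trans_eq (by simp)
          filter_upwards [hz 0] with ω h
          rwa [← sq]
        have h2 := dotProduct_sq_le z y
        rw [hzy, one_pow] at h2
        refine h2.trans (mul_le_mul_of_nonneg_right h1 ?_)
        exact Finset.sum_nonneg fun j _ => mul_self_nonneg _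
      set μ := y ⬝ᵥ y with hμ
      have hNc : N * c = 5 * L * κ := by rw [hc]; field_simp
      have e1 : D + N * E = 5 * L * (1 - 2 * κ + κ * μ
          + 5 / 9 * c * κ ^ 2 * (2 * p + 3) * (κ - 2 + μ)) := by
        have : N * E = N * c * ((κ - μ) + 5 / 9 * c * ((2 * p + 3) * κ * (κ - 2 + μ))) := by
          rw [hE]; ring
        rw [this, hNc, hD]; ring
      have hc2 : 5 / 9 * c * κ ^ 2 * (2 * p + 3) ≤ 1 := by
        calc _ ≤ 5 / 9 * (15 * κ / (28 * (p + 1))) * κ ^ 2 * (2 * p + 3) := by gcongr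
          _ = (5 / 9 * 15 / 28) * κ ^ 3 * ((2 * p + 3) / (p + 1)) := by
            field_simp
          _ ≤ (5 / 9 * 15 / 28) * (17 / 16) ^ 3 * (5 / 2) := by
            have : (2 * p + 3) / (p + 1) ≤ 5 / 2 := by
              rw [div_le_div_iff₀ (by linarith) (by norm_num)]; linarith
            gcongr
          _ ≤ 1 := by norm_num
      have hy1 : 0 ≤ κ - 2 + μ := by
        refine nonneg_of_mul_nonneg_right (a := κ) ?_ (by linarith)
        nlinarith [sq_nonneg (κ - 1)]
      rw [e1]
      -- Replacing the variance coefficient by 1 turns the bracket into (κ + 1)(μ - 1), which is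
      -- nonpositive because μ ≤ 1.
      have := mul_le_mul_of_nonneg_right hc2 hy1
      refine mul_nonpos_of_nonneg_of_nonpos (by positivity) ?_
      nlinarith

end Expectation

/-! ### The error budget for the random design. -/

section Tail

set_option linter.unusedSectionVars false

open Matrix NormedSpace

variable {ι : Type*} [Fintype ι] [DecidableEq ι]
variable {Ω : Type*} [MeasurableSpace Ω] {P : Measure Ω} [IsProbabilityMeasure P]

/-- The Laplace transform of the spectral distribution of the empirical second moment matrix of
the first `N` vectors of the sequence `x`. -/
noncomputable def laplace (N : ℕ) (x : ℕ → ι → ℝ) (s : ℝ) : ℝ :=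
  (exp (-s • ((N : ℝ)⁻¹ • gram (Finset.range N) x))).trace

theorem measurable_laplace {g : ℕ → Ω → ι → ℝ} (hg : ∀ n, Measurable (g n)) (N : ℕ) :
    Measurable (Function.uncurry fun (ω : Ω) s => laplace N (fun n => g n ω) s) := by
  have h0 : Continuous fun z : (ℕ → ι → ℝ) × ℝ => (N : ℝ)⁻¹ • gram (Finset.range N) z.1 :=
    Continuous.const_smul (g := fun z : (ℕ → ι → ℝ) × ℝ => gram (Finset.range N) z.1)
      ((continuous_gram _).comp continuous_fst) (N : ℝ)⁻¹
  have h1 : Continuous fun z : (ℕ → ι → ℝ) × ℝ => laplace N z.1 z.2 :=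
    continuous_trace_exp (continuous_snd.neg.smul h0)
  have h2 : Measurable fun z : Ω × ℝ => ((fun n => g n z.1 : ℕ → ι → ℝ), z.2) :=
    (measurable_pi_lambda _ fun n => (hg n).comp measurable_fst).prodMk measurable_snd
  exact h1.measurable.comp h2

variable {g : ℕ → Ω → ι → ℝ} (hg : ∀ n, Measurable (g n)) (hind : iIndepFun g P) {B : ℝ}
  (hB0 : 0 < B) (hB : ∀ n, ∀ᵐ ω ∂P, g n ω ⬝ᵥ g n ω ≤ B)
  (hcov : ∀ n k l, ∫ ω, g n ω k * g n ω l ∂P = (1 : Matrix ι ι ℝ) k l)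

include hg hind hB0 hB hcov

theorem lintegral_laplace_le {N : ℕ} (hN : 0 < N) (s : ℝ) :
    ∫⁻ ω, ENNReal.ofReal (laplace N (fun n => g n ω) s) ∂P ≤ ENNReal.ofReal
      (Fintype.card ι * Real.exp (-(N / B * (1 - Real.exp (-(s / (N / B))))))) := by
  have h := lintegral_trace_exp_smul_gram_le hg hind hB0 hB hcov (-s / N) N
  have e : ∀ ω, laplace N (fun n => g n ω) s
      = (exp ((-s / N) • gram (Finset.range N) fun n => g n ω)).trace := by
    intro ω
    rw [laplace, smul_smul, ← div_eq_mul_inv]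
  simp only [e]
  refine h.trans_eq ?_
  have hN' : (0 : ℝ) < N := by exact_mod_cast hN
  have e2 : -s / N * B = -(s / (N / B)) := by field_simp
  rw [e2]
  congr 3
  ring

/-- Markov's inequality at s = n log 2, the optimal Chernoff parameter for an eigenvalue below 1/2:
there exp(-s/n) = 1/2. -/
theorem measure_laplace_gt_le {N : ℕ} (hN : 0 < N) :
    P {ω | Real.exp (-(N / B * Real.log 2) / 2)
        < laplace N (fun n => g n ω) (N / B * Real.log 2)}
      ≤ ENNReal.ofReal (Fintype.card ι * Real.exp (-(N / B * ((1 - Real.log 2) / 2)))) := by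
  have hn : 0 < N / B := div_pos (by exact_mod_cast hN) hB0
  set n := N / B
  set s := n * Real.log 2 with hs
  have hm : Measurable fun ω => laplace N (fun n => g n ω) s :=
    (measurable_laplace hg N).comp measurable_prodMk_right
  have h1 := mul_meas_ge_le_lintegral (μ := P) hm.ennreal_ofReal
    (ENNReal.ofReal (Real.exp (-s / 2)))
  have h2 := h1.trans (lintegral_laplace_le hg hind hB0 hB hcov hN s)
  have e : Real.exp (-(s / n)) = 1 / 2 := by
    rw [hs, mul_div_cancel_left₀ _ hn.ne', Real.exp_neg, Real.exp_log (by norm_num)]; norm_num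
  rw [e] at h2
  have h3 : P {ω | Real.exp (-s / 2) < laplace N (fun n => g n ω) s} ≤
      P {ω | ENNReal.ofReal (Real.exp (-s / 2))
        ≤ ENNReal.ofReal (laplace N (fun n => g n ω) s)} :=
    measure_mono fun ω h => ENNReal.ofReal_le_ofReal (le_of_lt h)
  refine h3.trans ?_
  have hc : ENNReal.ofReal (Real.exp (s / 2)) * ENNReal.ofReal (Real.exp (-s / 2)) = 1 := by
    rw [← ENNReal.ofReal_mul (Real.exp_pos _).le, ← Real.exp_add]
    ring_nf
    simp
  calc _ = ENNReal.ofReal (Real.exp (s / 2)) * (ENNReal.ofReal (Real.exp (-s / 2)) * _) := by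
        rw [← mul_assoc, hc, one_mul]
    _ ≤ _ := mul_le_mul_right h2 _
    _ = _ := by
        rw [← ENNReal.ofReal_mul (Real.exp_pos _).le, mul_left_comm, ← Real.exp_add]
        congr 3
        rw [hs]; ring

/-- With u = 17L/(16n) ≤ 2/17, the loss 1 - u/2 ≥ 16/17 in n(1 - exp(-u)) is exactly offset by the
factor 17/16. This fixes the threshold between the two regimes of κ. -/
theorem lintegral_laplace_le_exp_neg {N : ℕ} (hN : 0 < N) {L : ℝ} (hL : 0 < L)
    (hn : 28 / 3 * L ≤ N / B) :
    ∫⁻ ω, ENNReal.ofReal (laplace N (fun n => g n ω) (17 / 16 * L)) ∂P ≤ ENNReal.ofReal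
      (Fintype.card ι * Real.exp (-L)) := by
  refine (lintegral_laplace_le hg hind hB0 hB hcov hN _).trans (ENNReal.ofReal_le_ofReal ?_)
  have hn0 : 0 < N / B := lt_of_lt_of_le (by positivity) hn
  set n := N / B
  gcongr
  set u := 17 / 16 * L / n with hu
  have hu0 : 0 < u := by positivity
  have h1 : Real.exp (-u) ≤ 1 - u + 1 / 2 * u ^ 2 := by
    have h := exp_neg_sub_one_add_le (x := u) (by linarith)
    have : 3 * u ^ 2 / (2 * (3 + u)) ≤ 1 / 2 * u ^ 2 := by
      rw [div_le_iff₀ (by linarith)]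
      nlinarith [pow_pos hu0 3]
    linarith
  have h2 : n * u = 17 / 16 * L := by rw [hu]; field_simp
  have h3 : u ≤ 2 / 17 := by
    rw [hu, div_le_iff₀ hn0]; linarith
  nlinarith

theorem measure_laplace_gt_add_lintegral_le {κ : ℝ} (hκ : 1 ≤ κ) (hBκ : B = Fintype.card ι * κ)
    {y z : ι → ι → ℝ} (hy : ∀ v, ∑ i, (y i ⬝ᵥ v) ^ 2 ≤ v ⬝ᵥ v) (hzy : ∀ i, z i ⬝ᵥ y i = 1)
    (hz : ∀ i n, ∀ᵐ ω ∂P, (z i ⬝ᵥ g n ω) ^ 2 ≤ κ) (hp : 0 < Fintype.card ι) {L : ℝ}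
    (hL : Real.log (3 * Fintype.card ι) ≤ L) {N : ℕ} (hN : 28 / 3 * (B + 1) * L ≤ N) :
    P {ω | Real.exp (-(N / B * Real.log 2) / 2)
        < laplace N (fun n => g n ω) (N / B * Real.log 2)} +
      ∫⁻ ω in {ω | laplace N (fun n => g n ω) (N / B * Real.log 2)
          ≤ Real.exp (-(N / B * Real.log 2) / 2)},
        ENNReal.ofReal (2 * ∑ i, Real.exp (-(κ * L /
          (y i ⬝ᵥ (((N : ℝ)⁻¹ • gram (Finset.range N) fun n => g n ω)⁻¹ *ᵥ y i))))) ∂P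
      ≤ ENNReal.ofReal (3 * (Fintype.card ι * Real.exp (-L))) := by
  have hp1 : (1 : ℝ) ≤ Fintype.card ι := by exact_mod_cast hp
  have hL1 : 1.0986 ≤ L := by
    have := (log_three_mul_ge one_pos hp).trans hL
    have := Real.log_three_gt_d9
    norm_num at *
    linarith
  have hL0 : 0 < L := by linarith
  have hN0 : (0 : ℝ) < N := lt_of_lt_of_le (by positivity) hN
  have hN0' : 0 < N := by exact_mod_cast hN0
  have hn : 28 / 3 * L * (1 + 1 / B) ≤ N / B := by
    rw [le_div_iff₀ hB0]
    refine le_trans (le_of_eq ?_) hN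
    field_simp
  have hn' : 28 / 3 * L ≤ N / B := by
    refine le_trans ?_ hn
    have : 0 < 1 / B := by positivity
    nlinarith
  have htail := measure_laplace_gt_le hg hind hB0 hB hcov hN0'
  have hE := lintegral_laplace_le hg hind hB0 hB hcov hN0'
  have hm := measurable_laplace hg N
  have hmeas : ∀ s, Measurable fun ω => laplace N (fun n => g n ω) s := fun s =>
    hm.comp measurable_prodMk_right
  set n := N / B with hnd
  have hn0 : 0 < n := by positivity
  set s₀ := n * Real.log 2 with hs₀
  have hs₀0 : 0 < s₀ := mul_pos hn0 (Real.log_pos (by norm_num))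
  set E₀ := {ω | laplace N (fun n => g n ω) s₀ ≤ Real.exp (-s₀ / 2)} with hE₀
  have hE₀m : MeasurableSet E₀ := measurableSet_le (hmeas s₀) measurable_const
  have hy0 : ∀ i, 0 < y i ⬝ᵥ y i := by
    intro i
    have h := dotProduct_sq_le (z i) (y i)
    rw [hzy, one_pow] at h
    have h0 : 0 ≤ y i ⬝ᵥ y i := Finset.sum_nonneg fun j _ => mul_self_nonneg _
    refine lt_of_le_of_ne h0 fun h1 => ?_
    rw [← h1] at h
    linarith
  have hG : ∀ ω, ((N : ℝ)⁻¹ • gram (Finset.range N) fun n => g n ω).IsSymm := fun ω =>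
    (isSymm_gram _ _).smul _
  set q : ℝ := (Fintype.card ι : ℝ) with hq
  -- a bound for the integrand on `E₀` which is a multiple of a value of the Laplace transform
  have large : ∀ c β : ℝ, 17 / 16 ≤ κ → 0 ≤ c → 0 ≤ β → β + 2 * c ≤ 3 →
      Real.exp (-(n * ((1 - Real.log 2) / 2))) ≤ β * Real.exp (-L) →
      (∀ ω ∈ E₀, ∑ i, Real.exp (-(17 / 16 * L /
          (y i ⬝ᵥ (((N : ℝ)⁻¹ • gram (Finset.range N) fun n => g n ω)⁻¹ *ᵥ y i))))
        ≤ c * laplace N (fun n => g n ω) (17 / 16 * L)) →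
      ENNReal.ofReal (q * Real.exp (-(n * ((1 - Real.log 2) / 2)))) +
      ∫⁻ ω in E₀, ENNReal.ofReal (2 * ∑ i, Real.exp (-(κ * L /
          (y i ⬝ᵥ (((N : ℝ)⁻¹ • gram (Finset.range N) fun n => g n ω)⁻¹ *ᵥ y i))))) ∂P
      ≤ ENNReal.ofReal (3 * (q * Real.exp (-L))) := by
    intro c β hκ2 hc hβ hcβ hβ' hle
    have hlap := lintegral_laplace_le_exp_neg hg hind hB0 hB hcov hN0' hL0 hn'
    have h1 : ∫⁻ ω in E₀, ENNReal.ofReal (2 * ∑ i, Real.exp (-(κ * L /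
          (y i ⬝ᵥ (((N : ℝ)⁻¹ • gram (Finset.range N) fun n => g n ω)⁻¹ *ᵥ y i))))) ∂P
        ≤ ENNReal.ofReal (2 * c) * ENNReal.ofReal (q * Real.exp (-L)) := by
      calc _ ≤ ∫⁻ ω in E₀, ENNReal.ofReal (2 * c)
              * ENNReal.ofReal (laplace N (fun n => g n ω) (17 / 16 * L)) ∂P := by
            refine setLIntegral_mono' hE₀m fun ω hω => ?_
            rw [← ENNReal.ofReal_mul (by positivity)]
            refine ENNReal.ofReal_le_ofReal ?_
            rw [mul_assoc]
            refine mul_le_mul_of_nonneg_left (le_trans ?_ (hle ω hω)) zero_le_two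
            refine Finset.sum_le_sum fun i _ => Real.exp_le_exp.2 (neg_le_neg ?_)
            obtain ⟨-, w, d, -, -, -, -, hpos, hinv, -⟩ :=
              exists_spectral_weights (hG ω) hy hy0 hs₀0 hω
            have : 0 < y i ⬝ᵥ (((N : ℝ)⁻¹ • gram (Finset.range N) fun n => g n ω)⁻¹ *ᵥ y i) := by
              rw [hinv]; exact hpos i
            gcongr
        _ ≤ ∫⁻ ω, ENNReal.ofReal (2 * c)
              * ENNReal.ofReal (laplace N (fun n => g n ω) (17 / 16 * L)) ∂P :=
            setLIntegral_le_lintegral _ _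
        _ ≤ _ := by
            rw [lintegral_const_mul' _ _ ENNReal.ofReal_ne_top]
            gcongr
    refine (add_le_add_right h1 _).trans ?_
    rw [← ENNReal.ofReal_mul (by positivity), ← ENNReal.ofReal_add (by positivity) (by positivity)]
    refine ENNReal.ofReal_le_ofReal ?_
    have h2 := mul_le_mul_of_nonneg_left hβ' (show 0 ≤ q by linarith)
    have h3 : 0 ≤ q * Real.exp (-L) := by positivity
    nlinarith
  refine (add_le_add_left htail _).trans ?_
  rcases le_total (17 / 16) κ with hκ2 | hκ2
  -- In dimension at least 2, L ≥ log 6 gives 17L/16 ≥ 19/10 and the budget is 1/2 + 2·6/5 < 3. In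
  -- dimension 1 it is 1 + 2 = 3.
  · rcases Nat.lt_or_ge 1 (Fintype.card ι) with hc | hc
    · refine large (6 / 5) (1 / 2) hκ2 (by norm_num) (by norm_num) (by norm_num)
        (exp_tail_le_half hc hL hn') fun ω hω => ?_
      refine sum_exp_neg_div_le (hG ω) hy hy0 hs₀0 hω ?_
      have h6 : Real.log 3 + Real.log 2 ≤ L := by
        rw [← Real.log_mul (by norm_num) (by norm_num)]
        exact (log_three_mul_ge (by norm_num) hc).trans hL
      have := Real.log_three_gt_d9
      have := Real.log_two_gt_d9
      linarith
    · refine large 1 1 hκ2 (by norm_num) (by norm_num) (by norm_num)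
        (by rw [one_mul]; exact exp_tail_le_one hL0.le hn') fun ω hω => ?_
      have hc1 : Fintype.card ι = 1 := le_antisymm hc hp
      refine (Finset.sum_le_sum fun i _ =>
        exp_neg_div_le_trace (hG ω) hy hy0 hs₀0 hω (by positivity) i).trans_eq ?_
      rw [Finset.sum_const, Finset.card_univ, hc1, one_smul, one_mul]
      rfl
  -- Here the budget is 1/4 + 2(1/5 + 4/5·733/500) = 2.9956.
  · have hBq : B ≤ 17 / 16 * q := by rw [hBκ]; nlinarith
    have hn2 : 28 / 3 * L * (1 + 16 / (17 * q)) ≤ n := by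
      refine le_trans ?_ hn
      have : 16 / (17 * q) ≤ 1 / B := by
        rw [div_le_div_iff₀ (by positivity) hB0]; linarith
      gcongr
    have hn10 : 10 ≤ n := by
      refine le_trans ?_ hn'; linarith
    have hquart := exp_tail_le_quarter hp hL hn2
    refine (add_le_add_right (setLIntegral_mono' (g := fun ω => ENNReal.ofReal 2 *
      (ENNReal.ofReal (Real.exp (-L)) * (ENNReal.ofReal (1 / 5) * ∑ i, ENNReal.ofReal (Real.exp
        (5 * (L * (1 - 2 * κ + 2 * κ * (y i ⬝ᵥ y i) - κ * (y i ⬝ᵥ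
          (((N : ℝ)⁻¹ • gram (Finset.range N) fun n => g n ω) *ᵥ y i))))))
        + ENNReal.ofReal (4 / 5) * mix n (laplace N fun n => g n ω)))) hE₀m fun ω hω => ?_) _).trans
      ((add_le_add_right (setLIntegral_le_lintegral _ _) _).trans ?_)
    · rw [ENNReal.ofReal_mul zero_le_two]
      exact mul_le_mul_right (sum_exp_neg_div_le_mix (hG ω) hy hy0 hs₀0 hω (by linarith) hL0.le
        hn10 (by nlinarith)) _
    have hquad : ∀ i, Measurable fun ω =>
        y i ⬝ᵥ (((N : ℝ)⁻¹ • gram (Finset.range N) fun n => g n ω) *ᵥ y i) := by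
      intro i
      have h1 : Continuous fun x : ℕ → ι → ℝ => (N : ℝ)⁻¹ • gram (Finset.range N) x :=
        Continuous.const_smul (continuous_gram (Finset.range N)) (N : ℝ)⁻¹
      exact ((continuous_quadLin (y i)).comp h1).measurable.comp (measurable_pi_lambda _ hg)
    have hexp : ∀ i, Measurable fun ω => ENNReal.ofReal (Real.exp
        (5 * (L * (1 - 2 * κ + 2 * κ * (y i ⬝ᵥ y i) - κ * (y i ⬝ᵥ
          (((N : ℝ)⁻¹ • gram (Finset.range N) fun n => g n ω) *ᵥ y i)))))) := by
      intro i
      have := hquad i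
      fun_prop
    have hmix := lintegral_mix_le (T := fun ω => laplace N fun n => g n ω) hm hn10
      (show 0 ≤ q by linarith) hE
    have hU : ∫⁻ ω, ∑ i, ENNReal.ofReal (Real.exp
        (5 * (L * (1 - 2 * κ + 2 * κ * (y i ⬝ᵥ y i) - κ * (y i ⬝ᵥ
          (((N : ℝ)⁻¹ • gram (Finset.range N) fun n => g n ω) *ᵥ y i)))))) ∂P
        ≤ ENNReal.ofReal q := by
      rw [lintegral_finsetSum _ fun i _ => hexp i]
      refine (Finset.sum_le_sum fun i _ => lintegral_exp_quadratic_form_le hg hind hκ hκ2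
        (fun n => by rw [← hBκ]; exact hB n) hcov hp (dotProduct_self_le_one hy i) (hzy i) (hz i)
        hL0 (by rw [← hBκ]; exact hN)).trans ?_
      simp [hq]
    rw [lintegral_const_mul' _ _ ENNReal.ofReal_ne_top,
      lintegral_const_mul' _ _ ENNReal.ofReal_ne_top,
      lintegral_add_left ((Finset.measurable_fun_sum _ fun i _ => hexp i).const_mul _),
      lintegral_const_mul' _ _ ENNReal.ofReal_ne_top,
      lintegral_const_mul' _ _ ENNReal.ofReal_ne_top]
    calc _ ≤ ENNReal.ofReal (q * Real.exp (-(n * ((1 - Real.log 2) / 2)))) + ENNReal.ofReal 2 *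
          (ENNReal.ofReal (Real.exp (-L)) * (ENNReal.ofReal (1 / 5) * ENNReal.ofReal q +
            ENNReal.ofReal (4 / 5) * ENNReal.ofReal (733 / 500 * q))) := by gcongr
      _ = ENNReal.ofReal (q * Real.exp (-(n * ((1 - Real.log 2) / 2))) + 2 *
          (Real.exp (-L) * (1 / 5 * q + 4 / 5 * (733 / 500 * q)))) := by
        rw [ENNReal.ofReal_add (by positivity) (by positivity),
          ENNReal.ofReal_mul (p := 2) (by positivity),
          ENNReal.ofReal_mul (p := Real.exp (-L)) (by positivity),
          ENNReal.ofReal_add (p := 1 / 5 * q) (by positivity) (by positivity),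
          ENNReal.ofReal_mul (p := 1 / 5) (by positivity),
          ENNReal.ofReal_mul (p := 4 / 5) (by positivity)]
      _ ≤ _ := by
        refine ENNReal.ofReal_le_ofReal ?_
        have h2 := mul_le_mul_of_nonneg_left hquart (show 0 ≤ q by linarith)
        have h3 : 0 ≤ q * Real.exp (-L) := by positivity
        nlinarith

end Tail

/-! ### Hoeffding for the noise, conditionally on the design. -/

section Noise

set_option linter.unusedSectionVars false

open Matrix

variable {Ω : Type*} [MeasurableSpace Ω] {P : Measure Ω} [IsProbabilityMeasure P]

theorem hasSubgaussianMGF_sum_mul {v : ℕ → Ω → ℝ} (hv : ∀ n, Measurable (v n))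
    (hmean : ∀ n, ∫ ω, v n ω ∂P = 0) (hind : iIndepFun v P) {b : ℝ} (hb : 0 ≤ b)
    (hvb : ∀ n, ∀ᵐ ω ∂P, |v n ω| ≤ b) (w : ℕ → ℝ) (N : ℕ) :
    HasSubgaussianMGF (fun ω => ∑ n ∈ Finset.range N, w n * v n ω)
      ((b ^ 2 * ∑ n ∈ Finset.range N, w n ^ 2).toNNReal) P := by
  have h1 : ∀ n, HasSubgaussianMGF (fun ω => w n * v n ω) ((w n ^ 2 * b ^ 2).toNNReal) P := by
    intro n
    have h := (hasSubgaussianMGF_of_mem_Icc_of_integral_eq_zero (hv n).aemeasurable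
      (a := -b) (b := b) ((hvb n).mono fun ω h => abs_le.1 h) (hmean n)).const_mul (w n)
    convert h using 1
    refine NNReal.eq ?_
    rw [Real.coe_toNNReal _ (by positivity)]
    change w n ^ 2 * b ^ 2 = w n ^ 2 * (|b - -b| / 2) ^ 2
    rw [abs_of_nonneg (by linarith)]
    ring
  have h2 : iIndepFun (fun n ω => w n * v n ω) P :=
    hind.comp (fun n x => w n * x) fun n => measurable_const_mul (w n)
  have h3 := HasSubgaussianMGF.sum_of_iIndepFun h2 (s := Finset.range N) fun n _ => h1 n
  convert h3 using 1
  rw [← Real.toNNReal_sum_of_nonneg fun n _ => by positivity, Finset.mul_sum]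
  simp only [mul_comm]

/-- Hoeffding's inequality for weighted sums of bounded centred variables. -/
theorem measure_abs_sum_mul_gt_le {v : ℕ → Ω → ℝ} (hv : ∀ n, Measurable (v n))
    (hmean : ∀ n, ∫ ω, v n ω ∂P = 0) (hind : iIndepFun v P) {b : ℝ} (hb : 0 ≤ b)
    (hvb : ∀ n, ∀ᵐ ω ∂P, |v n ω| ≤ b) (w : ℕ → ℝ) (N : ℕ) {r : ℝ} (hr : 0 ≤ r) :
    P {ω | r < |∑ n ∈ Finset.range N, w n * v n ω|} ≤ ENNReal.ofReal
      (2 * Real.exp (-(r ^ 2 / (2 * (b ^ 2 * ∑ n ∈ Finset.range N, w n ^ 2))))) := by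
  have h := hasSubgaussianMGF_sum_mul hv hmean hind hb hvb w N
  have h1 := h.measure_ge_le hr
  have h2 := h.neg.measure_ge_le hr
  rw [Real.coe_toNNReal _ (mul_nonneg (sq_nonneg b) (Finset.sum_nonneg fun n _ => sq_nonneg _)),
    neg_div] at h1 h2
  set S : Ω → ℝ := fun ω => ∑ n ∈ Finset.range N, w n * v n ω
  have hsub : {ω | r < |S ω|} ⊆ {ω | r ≤ S ω} ∪ {ω | r ≤ (-S) ω} := by
    intro ω hω
    rcases lt_abs.1 (show r < |S ω| from hω) with h | h
    · exact Or.inl h.le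
    · exact Or.inr h.le
  have hreal : P.real {ω | r < |S ω|} ≤
      2 * Real.exp (-(r ^ 2 / (2 * (b ^ 2 * ∑ n ∈ Finset.range N, w n ^ 2)))) := by
    refine (measureReal_mono hsub).trans ((measureReal_union_le _ _).trans ?_)
    linarith
  rw [Measure.real] at hreal
  exact ENNReal.le_ofReal_iff_toReal_le (measure_ne_top _ _) (by positivity) |>.2 hreal

variable {ι : Type*} [Fintype ι] [DecidableEq ι]

/-- The sum is the quadratic form of G at G⁻¹e_i, and G⁻¹GG⁻¹ = G⁻¹. It is the variance proxy in
Hoeffding's bound. -/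
theorem sum_sq_inv_gram_mulVec {N : ℕ} {x : ℕ → ι → ℝ} (hu : IsUnit (gram (Finset.range N) x))
    (i : ι) : ∑ n ∈ Finset.range N, ((gram (Finset.range N) x)⁻¹ *ᵥ x n) i ^ 2
      = (gram (Finset.range N) x)⁻¹ i i := by
  set G := gram (Finset.range N) x with hG
  have hs : (G⁻¹)ᵀ = G⁻¹ := by rw [transpose_nonsing_inv]; congr 1; exact isSymm_gram _ _
  have h1 := dotProduct_gram_mulVec (Finset.range N) x (G⁻¹ *ᵥ Pi.single i 1)
  rw [← hG, mulVec_mulVec, mul_nonsing_inv _ ((isUnit_iff_isUnit_det _).1 hu), one_mulVec] at h1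
  have h2 : ∀ n, G⁻¹ *ᵥ Pi.single i 1 ⬝ᵥ x n = (G⁻¹ *ᵥ x n) i := by
    intro n
    rw [← hs, mulVec_transpose, ← dotProduct_mulVec, single_one_dotProduct, hs]
  simp only [h2] at h1
  rw [← h1]
  simp

theorem measurable_inv_gram_mulVec (N : ℕ) (n : ℕ) (i : ι) :
    Measurable fun x : ℕ → ι → ℝ => ((gram (Finset.range N) x)⁻¹ *ᵥ x n) i := by
  have hG : Continuous fun x : ℕ → ι → ℝ => gram (Finset.range N) x := continuous_gram _
  have hdet := hG.matrix_det.measurable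
  have hadj : ∀ j, Measurable fun x : ℕ → ι → ℝ => (gram (Finset.range N) x).adjugate i j :=
    fun j => (hG.matrix_adjugate.matrix_elem i j).measurable
  simp only [mulVec, dotProduct, inv_def, Ring.inverse_eq_inv', Matrix.smul_apply, smul_eq_mul]
  exact Finset.measurable_fun_sum _ fun j _ => (hdet.inv.mul (hadj j)).mul
    ((measurable_pi_apply j).comp (measurable_pi_apply n))

/-- The event that one of the coordinates of the least squares error is large is controlled by
averaging over the design a bound for the noise. -/
theorem measure_and_exists_gt_le {a : ℕ → Ω → ι → ℝ} {v : ℕ → Ω → ℝ}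
    (ha : ∀ n, Measurable (a n)) (hv : ∀ n, Measurable (v n))
    (hmean : ∀ n, ∫ ω, v n ω ∂P = 0) (hind : iIndepFun v P)
    (hav : IndepFun (fun ω n => a n ω) (fun ω n => v n ω) P) {b : ℝ} (hb : 0 ≤ b)
    (hvb : ∀ n, ∀ᵐ ω ∂P, |v n ω| ≤ b) (N : ℕ) {r : ℝ} (hr : 0 ≤ r)
    {E : Set (ℕ → ι → ℝ)} (hE : MeasurableSet E)
    (hEu : ∀ x ∈ E, IsUnit (gram (Finset.range N) x)) :
    P {ω | (fun n => a n ω) ∈ E ∧ ∃ i, r < |∑ n ∈ Finset.range N,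
        ((gram (Finset.range N) fun n => a n ω)⁻¹ *ᵥ a n ω) i * v n ω|}
      ≤ ∫⁻ ω in (fun ω n => a n ω) ⁻¹' E, ENNReal.ofReal (2 * ∑ i, Real.exp (-(r ^ 2 /
        (2 * (b ^ 2 * (gram (Finset.range N) fun n => a n ω)⁻¹ i i))))) ∂P := by
  have hX : Measurable fun ω n => a n ω := measurable_pi_lambda _ ha
  have hU : Measurable fun ω n => v n ω := measurable_pi_lambda _ hv
  set F : ι → (ℕ → ι → ℝ) × (ℕ → ℝ) → ℝ := fun i z => ∑ n ∈ Finset.range N,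
        ((gram (Finset.range N) z.1)⁻¹ *ᵥ z.1 n) i * z.2 n with hF
  have hFm : ∀ i, Measurable (F i) := fun i => Finset.measurable_fun_sum _ fun n _ =>
    ((measurable_inv_gram_mulVec N n i).comp measurable_fst).mul
      ((measurable_pi_apply n).comp measurable_snd)
  set S : Set ((ℕ → ι → ℝ) × (ℕ → ℝ)) := Prod.fst ⁻¹' E ∩ ⋃ i, {z | r < |F i z|} with hSdef
  have hS : MeasurableSet S := (hE.preimage measurable_fst).inter
    (MeasurableSet.iUnion fun i => measurableSet_lt measurable_const (hFm i).abs)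
  have e : {ω | (fun n => a n ω) ∈ E ∧ ∃ i, r < |∑ n ∈ Finset.range N,
        ((gram (Finset.range N) fun n => a n ω)⁻¹ *ᵥ a n ω) i * v n ω|}
      = (fun ω => ((fun n => a n ω : ℕ → ι → ℝ), (fun n => v n ω : ℕ → ℝ))) ⁻¹' S := by
    ext ω
    simp [hSdef, hF]
  have : IsProbabilityMeasure (P.map fun ω n => v n ω) :=
    Measure.isProbabilityMeasure_map hU.aemeasurable
  rw [e, ← Measure.map_apply (hX.prodMk hU) hS,
    hav.map_prod_eq_prod_map_map hX.aemeasurable hU.aemeasurable, Measure.prod_apply hS,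
    lintegral_map (measurable_measure_prodMk_left hS) hX,
    ← lintegral_indicator (hE.preimage hX)]
  refine lintegral_mono fun ω => ?_
  by_cases hω : (fun n => a n ω) ∈ E
  · rw [Set.indicator_of_mem (by exact hω), Measure.map_apply hU (hS.preimage measurable_prodMk_left)]
    calc _ ≤ P (⋃ i, {ω' | r < |∑ n ∈ Finset.range N,
          ((gram (Finset.range N) fun n => a n ω)⁻¹ *ᵥ a n ω) i * v n ω'|}) := by
          refine measure_mono fun ω' h => ?_
          obtain ⟨i, hi⟩ := Set.mem_iUnion.1 h.2
          exact Set.mem_iUnion.2 ⟨i, hi⟩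
      _ ≤ ∑ i, P {ω' | r < |∑ n ∈ Finset.range N,
          ((gram (Finset.range N) fun n => a n ω)⁻¹ *ᵥ a n ω) i * v n ω'|} :=
          measure_iUnion_fintype_le _ _
      _ ≤ ∑ i, ENNReal.ofReal (2 * Real.exp (-(r ^ 2 /
        (2 * (b ^ 2 * (gram (Finset.range N) fun n => a n ω)⁻¹ i i))))) := by
          refine Finset.sum_le_sum fun i _ => ?_
          -- With the design frozen at `ω`, the weights are deterministic and only `ω'` varies in
          -- the noise.
          rw [← sum_sq_inv_gram_mulVec (hEu _ hω)]
          exact measure_abs_sum_mul_gt_le hv hmean hind hb hvb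
            (fun n => ((gram (Finset.range N) fun n => a n ω)⁻¹ *ᵥ a n ω) i) N hr
      _ = _ := by
          rw [Finset.mul_sum, ENNReal.ofReal_sum_of_nonneg fun i _ => by positivity]
  · have : Prod.mk (fun n => a n ω) ⁻¹' S = ∅ := by
      ext u
      simp [hSdef, hω]
    rw [this, measure_empty]
    exact zero_le

end Noise

/-! ### Whitening and extreme eigenvalues. -/

section Whitening

set_option linter.unusedSectionVars false

open Matrix

variable {ι : Type*} [Fintype ι] [DecidableEq ι]

theorem isSymm_of_posDef {M : Matrix ι ι ℝ} (hM : M.PosDef) : M.IsSymm := by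
  have := hM.1
  rwa [IsHermitian, conjTranspose_eq_transpose_of_trivial] at this

theorem lambdaMin_pos {p : ℕ} (hp : 0 < p) {M : Matrix (Fin p) (Fin p) ℝ} (hM : M.PosDef) :
    0 < lambdaMin M := by
  rw [lambdaMin, hM.1.spectrum_real_eq_range_eigenvalues]
  have : Nonempty (Fin p) := ⟨⟨0, hp⟩⟩
  obtain ⟨j, hj⟩ := (Set.range_nonempty hM.1.eigenvalues).csInf_mem (Set.finite_range _)
  rw [← hj]
  exact hM.eigenvalues_pos j

theorem lambdaMin_le_lambdaMax {p : ℕ} (hp : 0 < p) {M : Matrix (Fin p) (Fin p) ℝ}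
    (hM : M.PosDef) : lambdaMin M ≤ lambdaMax M := by
  rw [lambdaMin, lambdaMax, hM.1.spectrum_real_eq_range_eigenvalues]
  have : Nonempty (Fin p) := ⟨⟨0, hp⟩⟩
  exact csInf_le_csSup (Set.range_nonempty _) (Set.finite_range _).bddBelow
    (Set.finite_range _).bddAbove

theorem lambdaMin_le_of_diagonalization {p : ℕ} {M : Matrix (Fin p) (Fin p) ℝ} (hM : M.PosDef)
    {V : Matrix (Fin p) (Fin p) ℝ} {d : Fin p → ℝ} (h : V * Vᵀ = 1)
    (hMd : M = V * diagonal d * Vᵀ) (j : Fin p) : lambdaMin M ≤ d j := by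
  have hb : BddBelow (spectrum ℝ M) := by
    rw [hM.1.spectrum_real_eq_range_eigenvalues]
    exact (Set.finite_range _).bddBelow
  refine csInf_le hb ?_
  rw [spectrum.mem_iff, isUnit_iff_isUnit_det]
  have e : algebraMap ℝ (Matrix (Fin p) (Fin p) ℝ) (d j) - M
      = V * diagonal (fun i => d j - d i) * Vᵀ := by
    have h1 : (diagonal fun i => d j - d i) = algebraMap ℝ (Matrix (Fin p) (Fin p) ℝ) (d j)
        - diagonal d := by
      rw [algebraMap_eq_diagonal, diagonal_sub]; rfl
    rw [h1, mul_sub, sub_mul, ← Algebra.commutes, Matrix.mul_assoc, h, mul_one, hMd]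
  rw [e, det_mul, det_mul, det_diagonal, Finset.prod_eq_zero (Finset.mem_univ j) (sub_self _)]
  simp

/-- A linear map turning the quadratic form of `M` into the standard one. -/
theorem exists_whitening {p : ℕ} (hp : 0 < p) {M : Matrix (Fin p) (Fin p) ℝ} (hM : M.PosDef) :
    ∃ W : Matrix (Fin p) (Fin p) ℝ, W * M * Wᵀ = 1 ∧
      ∀ u, lambdaMin M * (W *ᵥ u ⬝ᵥ W *ᵥ u) ≤ u ⬝ᵥ u := by
  obtain ⟨V, d, h1, h2, hMd⟩ := exists_orthogonal_diagonalization (isSymm_of_posDef hM)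
  have hσ := lambdaMin_pos hp hM
  have hd := lambdaMin_le_of_diagonalization hM h1 hMd
  have hd0 : ∀ j, 0 < d j := fun j => hσ.trans_le (hd j)
  refine ⟨diagonal (fun j => 1 / √(d j)) * Vᵀ, ?_, fun u => ?_⟩
  · rw [transpose_mul, transpose_transpose, diagonal_transpose, hMd]
    calc _ = diagonal (fun j => 1 / √(d j)) * (Vᵀ * V) * diagonal d * (Vᵀ * V) *
          diagonal (fun j => 1 / √(d j)) := by simp only [Matrix.mul_assoc]
      _ = 1 := by
        rw [h2, Matrix.mul_one, Matrix.mul_one, diagonal_mul_diagonal, diagonal_mul_diagonal,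
          ← diagonal_one]
        congr 1
        funext j
        have h3 := Real.mul_self_sqrt (hd0 j).le
        have h4 : √(d j) ≠ 0 := (Real.sqrt_pos.2 (hd0 j)).ne'
        field_simp
        nlinarith
  · rw [← sum_sq_orthogonal_mulVec h1 u, dotProduct, Finset.mul_sum]
    refine Finset.sum_le_sum fun j _ => ?_
    rw [← mulVec_mulVec, mulVec_diagonal]
    have h3 := Real.mul_self_sqrt (hd0 j).le
    have h4 : √(d j) ≠ 0 := (Real.sqrt_pos.2 (hd0 j)).ne'
    have e : lambdaMin M * (1 / √(d j) * (Vᵀ *ᵥ u) j * (1 / √(d j) * (Vᵀ *ᵥ u) j))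
        = lambdaMin M / d j * (Vᵀ *ᵥ u) j ^ 2 := by
      calc _ = lambdaMin M / (√(d j) * √(d j)) * (Vᵀ *ᵥ u) j ^ 2 := by field_simp
        _ = _ := by rw [h3]
    rw [e]
    exact mul_le_of_le_one_left (sq_nonneg _) ((div_le_one (hd0 j)).2 (hd j))

/-- A matrix and its transpose have the same operator norm, here by Cauchy–Schwarz. This yields the
Bessel inequality for the rescaled columns of `W`. -/
theorem dotProduct_transpose_whitening_le {W : Matrix ι ι ℝ} {σ : ℝ} (hσ : 0 < σ)
    (hle : ∀ u, σ * (W *ᵥ u ⬝ᵥ W *ᵥ u) ≤ u ⬝ᵥ u) (u : ι → ℝ) :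
    σ * (Wᵀ *ᵥ u ⬝ᵥ Wᵀ *ᵥ u) ≤ u ⬝ᵥ u := by
  set x := Wᵀ *ᵥ u with hx
  have h1 : x ⬝ᵥ x = u ⬝ᵥ (W *ᵥ x) := by
    rw [dotProduct_mulVec u, ← mulVec_transpose]
  have h2 := dotProduct_sq_le u (W *ᵥ x)
  have h3 := hle x
  rw [← h1] at h2
  have hx0 : 0 ≤ x ⬝ᵥ x := Finset.sum_nonneg fun j _ => mul_self_nonneg _
  have hu0 : 0 ≤ u ⬝ᵥ u := Finset.sum_nonneg fun j _ => mul_self_nonneg _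
  rcases hx0.eq_or_lt with h | h
  · rw [← h, mul_zero]; exact hu0
  · have : σ * (x ⬝ᵥ x) ^ 2 ≤ (u ⬝ᵥ u) * (x ⬝ᵥ x) := by
      nlinarith [mul_le_mul_of_nonneg_left h3 hu0, mul_le_mul_of_nonneg_left h2 hσ.le]
    refine le_of_mul_le_mul_right ?_ h
    nlinarith

theorem gram_mulVec (W : Matrix ι ι ℝ) (s : Finset ℕ) (x : ℕ → ι → ℝ) :
    gram s (fun n => W *ᵥ x n) = W * gram s x * Wᵀ := by
  rw [gram, gram, Finset.mul_sum, Finset.sum_mul]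
  refine Finset.sum_congr rfl fun n _ => ?_
  rw [mul_vecMulVec, vecMulVec_mul, vecMul_transpose]

theorem isUnit_of_isUnit_conj {W G : Matrix ι ι ℝ} {c : ℝ}
    (hu : IsUnit (c • (W * G * Wᵀ))) : IsUnit G := by
  rw [isUnit_iff_isUnit_det, det_smul, det_mul, det_mul] at hu
  rw [isUnit_iff_isUnit_det]
  exact isUnit_of_mul_isUnit_right (isUnit_of_mul_isUnit_left (isUnit_of_mul_isUnit_right hu))

section

variable {M W : Matrix ι ι ℝ} (hW : W * M * Wᵀ = 1)

include hW

theorem mul_transpose_mul_self_of_whitening : M * (Wᵀ * W) = 1 := by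
  rw [Matrix.mul_assoc] at hW
  have := mul_eq_one_comm.1 hW
  rwa [Matrix.mul_assoc] at this

theorem transpose_mul_self_mul_of_whitening : Wᵀ * W * M = 1 :=
  mul_eq_one_comm.1 (mul_transpose_mul_self_of_whitening hW)

theorem dotProduct_whitening (u x : ι → ℝ) :
    (W *ᵥ (M *ᵥ u)) ⬝ᵥ (W *ᵥ x) = u ⬝ᵥ x := by
  rw [dotProduct_mulVec, ← mulVec_transpose, mulVec_mulVec, mulVec_mulVec,
    transpose_mul_self_mul_of_whitening hW, one_mulVec]

theorem dotProduct_inv_whitening {G : Matrix ι ι ℝ} {c : ℝ} (hc : c ≠ 0)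
    (hu : IsUnit G) (i : ι) :
    (W *ᵥ Pi.single i 1) ⬝ᵥ ((c • (W * G * Wᵀ))⁻¹ *ᵥ (W *ᵥ Pi.single i 1)) = c⁻¹ * G⁻¹ i i := by
  have hG := (isUnit_iff_isUnit_det _).1 hu
  have hinv : (c • (W * G * Wᵀ))⁻¹ = c⁻¹ • (W * M * G⁻¹ * (M * Wᵀ)) := by
    refine inv_eq_right_inv ?_
    rw [smul_mul_smul_comm, mul_inv_cancel₀ hc, one_smul]
    calc _ = W * (G * (Wᵀ * W * M) * G⁻¹) * (M * Wᵀ) := by simp only [Matrix.mul_assoc]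
      _ = W * M * Wᵀ := by
        rw [transpose_mul_self_mul_of_whitening hW, Matrix.mul_one, mul_nonsing_inv _ hG,
          Matrix.mul_one, Matrix.mul_assoc]
      _ = 1 := hW
  have e : W * M * G⁻¹ * (M * Wᵀ) * W = W * M * G⁻¹ := by
    rw [Matrix.mul_assoc, Matrix.mul_assoc M, mul_transpose_mul_self_of_whitening hW,
      Matrix.mul_one]
  rw [hinv, smul_mulVec, dotProduct_smul, mulVec_mulVec, e, Matrix.mul_assoc, ← mulVec_mulVec,
    ← mulVec_mulVec, dotProduct_comm, dotProduct_whitening hW, smul_eq_mul]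
  simp

end

end Whitening

/-! ### The least squares error and the row second moments. -/

section Design

open Matrix

variable {Ω : Type*} {p : ℕ}

theorem design_transpose_mul_self (a : ℕ → Ω → Fin p → ℝ) (N : ℕ) (ω : Ω) :
    (design a N ω)ᵀ * design a N ω = gram (Finset.range N) fun n => a n ω := by
  ext i j
  rw [mul_apply, gram, Matrix.sum_apply, Finset.sum_range]
  rfl

theorem estimator_output_sub (a : ℕ → Ω → Fin p → ℝ) (v : ℕ → Ω → ℝ) (θ₀ : Fin p → ℝ) (N : ℕ)
    (ω : Ω) (hu : IsUnit (gram (Finset.range N) fun n => a n ω)) (i : Fin p) :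
    (estimator (design a N ω) (output a v θ₀ N ω) - θ₀) i = ∑ n ∈ Finset.range N,
      ((gram (Finset.range N) fun n => a n ω)⁻¹ *ᵥ a n ω) i * v n ω := by
  have hG := (isUnit_iff_isUnit_det _).1 hu
  rw [estimator, output, design_transpose_mul_self, mulVec_add, mulVec_mulVec, Matrix.mul_assoc,
    design_transpose_mul_self, nonsing_inv_mul _ hG, one_mulVec, add_sub_cancel_left,
    Finset.sum_range]
  rfl

variable [MeasurableSpace Ω] {P : Measure Ω} [IsProbabilityMeasure P]

/-- The averaged second moments equal `M` for every sample size, so subtracting consecutive partial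
sums gives each row the second moment `M`, although the rows need not be identically distributed. -/
theorem integral_mul_eq_of_expMatrix {a : ℕ → Ω → Fin p → ℝ} (ha : ∀ n, Measurable (a n))
    {α : ℝ} (hα : ∀ n i, ∀ᵐ ω ∂P, |a n ω i| ≤ α) {M : Matrix (Fin p) (Fin p) ℝ}
    (hM : ∀ N : ℕ, 0 < N → M = (1 / (N : ℝ)) •
      expMatrix P (fun ω => (design a N ω)ᵀ * design a N ω)) (n : ℕ) (i j : Fin p) :
    ∫ ω, a n ω i * a n ω j ∂P = M i j := by
  have hi : ∀ n, Integrable (fun ω => a n ω i * a n ω j) P := by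
    intro n
    have := ha n
    refine Integrable.of_bound (by fun_prop) (α * α) ?_
    filter_upwards [hα n i, hα n j] with ω h1 h2
    rw [norm_mul]
    exact mul_le_mul h1 h2 (abs_nonneg _) ((abs_nonneg _).trans h1)
  have hS : ∀ N : ℕ, ∑ n ∈ Finset.range N, ∫ ω, a n ω i * a n ω j ∂P = N * M i j := by
    intro N
    rcases Nat.eq_zero_or_pos N with rfl | hN
    · simp
    have h := congrFun (congrFun (hM N hN) i) j
    have e : ∀ ω, ((design a N ω)ᵀ * design a N ω) i j
        = ∑ n ∈ Finset.range N, a n ω i * a n ω j := by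
      intro ω
      rw [mul_apply, Finset.sum_range]
      rfl
    rw [Matrix.smul_apply, expMatrix, of_apply] at h
    simp only [e] at h
    rw [integral_finsetSum _ fun n _ => hi n] at h
    have hN' : (N : ℝ) ≠ 0 := by exact_mod_cast hN.ne'
    rw [h, smul_eq_mul]
    field_simp
  have h1 := hS (n + 1)
  rw [Finset.sum_range_succ, hS n] at h1
  push_cast at h1
  linarith

end Design

/-! ### Assembly of the failure probability. -/

section Main

open Matrix

variable {Ω : Type*} [MeasurableSpace Ω] {P : Measure Ω} [IsProbabilityMeasure P] {p : ℕ}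

/-- The whitened rows of a random design are isotropic. -/
theorem integral_whitened_mul {a : Ω → Fin p → ℝ} (ha : Measurable a)
    {α : ℝ} (hα : ∀ i, ∀ᵐ ω ∂P, |a ω i| ≤ α) {M W : Matrix (Fin p) (Fin p) ℝ}
    (hM : ∀ i j, ∫ ω, a ω i * a ω j ∂P = M i j) (hW : W * M * Wᵀ = 1) (k l : Fin p) :
    ∫ ω, (W *ᵥ a ω) k * (W *ᵥ a ω) l ∂P = (1 : Matrix (Fin p) (Fin p) ℝ) k l := by
  have hi : ∀ i j, Integrable (fun ω => a ω i * a ω j) P := by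
    intro i j
    refine Integrable.of_bound (by fun_prop) (α * α) ?_
    filter_upwards [hα i, hα j] with ω h1 h2
    rw [norm_mul]
    exact mul_le_mul h1 h2 (abs_nonneg _) ((abs_nonneg _).trans h1)
  have e : ∀ ω, (W *ᵥ a ω) k * (W *ᵥ a ω) l
      = ∑ j, ∑ i, W k i * W l j * (a ω i * a ω j) := by
    intro ω
    rw [mulVec, mulVec, dotProduct, dotProduct, Finset.sum_mul_sum, Finset.sum_comm]
    exact Finset.sum_congr rfl fun j _ => Finset.sum_congr rfl fun i _ => by ring
  simp only [e]
  rw [integral_finsetSum _ fun j _ => integrable_finsetSum _ fun i _ => (hi i j).const_mul _]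
  simp only [integral_finsetSum _ fun i _ => (hi i _).const_mul _, integral_const_mul, hM]
  rw [← hW, mul_apply]
  refine Finset.sum_congr rfl fun j _ => ?_
  rw [mul_apply, Finset.sum_mul]
  exact Finset.sum_congr rfl fun i _ => by rw [transpose_apply]; ring

/-- Cauchy–Schwarz for the whitened pair WMe_i, We_i gives 1 ≤ M_ii·|We_i|². It is needed for κ ≥ 1.
-/
theorem lambdaMin_le_apply_self {M : Matrix (Fin p) (Fin p) ℝ} (hM : M.PosDef) (i : Fin p) :
    lambdaMin M ≤ M i i := by
  obtain ⟨W, hW, hWle⟩ := exists_whitening i.pos hM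
  have h1 := dotProduct_sq_le (W *ᵥ (M *ᵥ Pi.single i 1)) (W *ᵥ Pi.single i 1)
  rw [dotProduct_whitening hW, dotProduct_whitening hW] at h1
  have h2 := hWle (Pi.single i 1)
  have h3 : (Pi.single i 1 : Fin p → ℝ) ⬝ᵥ Pi.single i 1 = 1 := by simp
  have h4 : (Pi.single i 1 : Fin p → ℝ) ⬝ᵥ (M *ᵥ Pi.single i 1) = M i i := by simp
  rw [h3, h4] at h1
  rw [h3] at h2
  have h6 : 0 < M i i := hM.diag_pos
  nlinarith [mul_le_mul_of_nonneg_left h2 h6.le, lambdaMin_pos i.pos hM]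

theorem lambdaMin_le_sq (hp : 0 < p) {a : ℕ → Ω → Fin p → ℝ} {M : Matrix (Fin p) (Fin p) ℝ}
    {α : ℝ} (hM : M.PosDef) (hα : ∀ n i, ∀ᵐ ω ∂P, |a n ω i| ≤ α)
    (hcov : ∀ n i j, ∫ ω, a n ω i * a n ω j ∂P = M i j) : lambdaMin M ≤ α ^ 2 := by
  refine (lambdaMin_le_apply_self hM ⟨0, hp⟩).trans ?_
  rw [← hcov 0]
  have hle : ∀ᵐ ω ∂P, a 0 ω ⟨0, hp⟩ * a 0 ω ⟨0, hp⟩ ≤ α ^ 2 := by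
    filter_upwards [hα 0 ⟨0, hp⟩] with ω h
    rw [← sq]
    exact sq_le_sq' (abs_le.1 h).1 (abs_le.1 h).2
  exact (integral_mono_of_nonneg (Filter.Eventually.of_forall fun ω => mul_self_nonneg _)
    (integrable_const (α ^ 2)) hle).trans_eq (by simp)

/-- The probability that the least squares estimator is undefined or misses its target by more
than `r`. -/
theorem measure_failure_le {a : ℕ → Ω → Fin p → ℝ} {v : ℕ → Ω → ℝ} (hp : 0 < p)
    (θ₀ : Fin p → ℝ) (ha : ∀ n, Measurable (a n)) (hv : ∀ n, Measurable (v n))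
    {M : Matrix (Fin p) (Fin p) ℝ} {α b : ℝ} (hmean : ∀ n, ∫ ω, v n ω ∂P = 0)
    (hrows : iIndepFun a P) (hα : ∀ n i, ∀ᵐ ω ∂P, |a n ω i| ≤ α) (hM : M.PosDef)
    (hcov : ∀ n i j, ∫ ω, a n ω i * a n ω j ∂P = M i j) (hind : iIndepFun v P)
    (hav : IndepFun (fun ω n => a n ω) (fun ω n => v n ω) P) (hb : 0 < b)
    (hvb : ∀ n, ∀ᵐ ω ∂P, |v n ω| ≤ b) {r L : ℝ} (hr : 0 < r) (hL : Real.log (3 * p) ≤ L) {N : ℕ}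
    (hN : 28 / 3 * (p * (α ^ 2 / lambdaMin M) + 1) * L ≤ N)
    (hNb : 2 * α ^ 2 * b ^ 2 / (r ^ 2 * lambdaMin M ^ 2) * L ≤ N) :
    P {ω | ¬ IsUnit ((design a N ω)ᵀ * design a N ω) ∨
        r < ‖estimator (design a N ω) (output a v θ₀ N ω) - θ₀‖}
      ≤ ENNReal.ofReal (3 * (p * Real.exp (-L))) := by
  obtain ⟨W, hW, hWle⟩ := exists_whitening hp hM
  have hσ := lambdaMin_pos hp hM
  set σ := lambdaMin M with hσd
  have hp1 : (1 : ℝ) ≤ p := by exact_mod_cast hp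
  set e : Fin p → Fin p → ℝ := fun i => Pi.single i 1 with he
  have hα2 : σ ≤ α ^ 2 := lambdaMin_le_sq hp hM hα hcov
  set κ := α ^ 2 / σ with hκd
  have hκ : 1 ≤ κ := (one_le_div hσ).2 hα2
  set g : ℕ → Ω → Fin p → ℝ := fun n ω => W *ᵥ a n ω with hg
  have hgm : ∀ n, Measurable (g n) := fun n =>
    (Continuous.matrix_mulVec continuous_const continuous_id).measurable.comp (ha n)
  have hgi : iIndepFun g P := hrows.comp (fun _ x => W *ᵥ x) fun _ =>
    (Continuous.matrix_mulVec continuous_const continuous_id).measurable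
  set B := (p : ℝ) * κ with hBd
  have hB0 : 0 < B := by positivity
  have hgB : ∀ n, ∀ᵐ ω ∂P, g n ω ⬝ᵥ g n ω ≤ B := by
    intro n
    filter_upwards [ae_all_iff.2 (hα n)] with ω h
    have h1 := hWle (a n ω)
    have h2 : a n ω ⬝ᵥ a n ω ≤ p * α ^ 2 := by
      refine (Finset.sum_le_sum (g := fun _ => α ^ 2) fun i _ => ?_).trans_eq (by simp)
      rw [← sq]
      exact sq_le_sq' (abs_le.1 (h i)).1 (abs_le.1 (h i)).2
    rw [hBd, hκd, mul_div_assoc', le_div_iff₀ hσ, mul_comm]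
    exact h1.trans h2
  have hgcov : ∀ n k l, ∫ ω, g n ω k * g n ω l ∂P = (1 : Matrix (Fin p) (Fin p) ℝ) k l :=
    fun n => integral_whitened_mul (ha n) (hα n) (hcov n) hW
  have hσs : √σ * √σ = σ := Real.mul_self_sqrt hσ.le
  have hσ0 : √σ ≠ 0 := (Real.sqrt_pos.2 hσ).ne'
  -- The factor √σ gives Bessel's inequality for `y`. The dual family `z` satisfies z_i·g_n =
  -- a_{ni}/√σ, so the entrywise bound on the design becomes (z_i·g_n)² ≤ κ.
  set y : Fin p → Fin p → ℝ := fun i => √σ • (W *ᵥ e i) with hyd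
  set z : Fin p → Fin p → ℝ := fun i => (√σ)⁻¹ • (W *ᵥ (M *ᵥ e i)) with hzd
  have hy : ∀ u, ∑ i, (y i ⬝ᵥ u) ^ 2 ≤ u ⬝ᵥ u := by
    intro u
    refine le_trans (le_of_eq ?_) (dotProduct_transpose_whitening_le hσ hWle u)
    rw [dotProduct, Finset.mul_sum]
    refine Finset.sum_congr rfl fun i _ => ?_
    have : (W *ᵥ e i) ⬝ᵥ u = (Wᵀ *ᵥ u) i := by
      rw [dotProduct_comm, dotProduct_mulVec, ← mulVec_transpose]
      simp [he]
    rw [hyd]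
    simp only [smul_dotProduct, smul_eq_mul, this]
    rw [mul_pow, sq, hσs, sq]
  have hzy : ∀ i, z i ⬝ᵥ y i = 1 := by
    intro i
    simp only [hyd, hzd, smul_dotProduct, dotProduct_smul, smul_eq_mul, dotProduct_whitening hW]
    rw [show e i ⬝ᵥ e i = 1 by simp [he]]
    field_simp
  have hz : ∀ i n, ∀ᵐ ω ∂P, (z i ⬝ᵥ g n ω) ^ 2 ≤ κ := by
    intro i n
    filter_upwards [hα n i] with ω h
    have h1 : z i ⬝ᵥ g n ω = (√σ)⁻¹ * a n ω i := by
      simp only [hzd, hg, smul_dotProduct, smul_eq_mul, dotProduct_whitening hW]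
      simp [he]
    rw [h1, mul_pow, inv_pow, sq (√σ), hσs, hκd, div_eq_inv_mul]
    exact mul_le_mul_of_nonneg_left (sq_le_sq' (abs_le.1 h).1 (abs_le.1 h).2)
      (inv_nonneg.2 hσ.le)
  have hL0 : 0 < L := lt_of_lt_of_le (Real.log_pos (by linarith)) hL
  have hN0 : (0 : ℝ) < N := lt_of_lt_of_le (by positivity) hN
  have hmain := measure_laplace_gt_add_lintegral_le hgm hgi hB0 hgB hgcov hκ
    (by rw [Fintype.card_fin]) hy hzy hz (by rwa [Fintype.card_fin])
    (by rwa [Fintype.card_fin]) hN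
  rw [Fintype.card_fin] at hmain
  set s₀ := N / B * Real.log 2 with hs₀
  have hs₀0 : 0 < s₀ := mul_pos (by positivity) (Real.log_pos (by norm_num))
  set E : Set (ℕ → Fin p → ℝ) := {x | laplace N (fun n => W *ᵥ x n) s₀ ≤ Real.exp (-s₀ / 2)}
    with hEd
  have hE : MeasurableSet E := by
    refine measurableSet_le ?_ measurable_const
    exact (measurable_laplace (g := fun n (x : ℕ → Fin p → ℝ) => W *ᵥ x n) (fun n =>
      (Continuous.matrix_mulVec continuous_const (continuous_apply n)).measurable) N).comp
        measurable_prodMk_right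
  have hy0 : ∀ i, 0 < y i ⬝ᵥ y i := by
    intro i
    have h := dotProduct_sq_le (z i) (y i)
    rw [hzy, one_pow] at h
    have h0 : 0 ≤ y i ⬝ᵥ y i := Finset.sum_nonneg fun j _ => mul_self_nonneg _
    refine lt_of_le_of_ne h0 fun h1 => ?_
    rw [← h1] at h
    linarith
  have hconj : ∀ x : ℕ → Fin p → ℝ, (N : ℝ)⁻¹ • gram (Finset.range N) (fun n => W *ᵥ x n)
      = (N : ℝ)⁻¹ • (W * gram (Finset.range N) x * Wᵀ) := fun x => by rw [gram_mulVec]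
  have hEu : ∀ x ∈ E, IsUnit (gram (Finset.range N) x) := by
    intro x hx
    have h := (exists_spectral_weights ((isSymm_gram (Finset.range N) fun n => W *ᵥ x n).smul
      (N : ℝ)⁻¹) hy hy0 hs₀0 hx).1
    rw [hconj] at h
    exact isUnit_of_isUnit_conj h
  have hnoise := measure_and_exists_gt_le ha hv hmean hind hav hb.le hvb N hr.le hE hEu
  -- The noise condition on `N` enters here: it makes the Hoeffding exponent at least κL/t_i, where
  -- t_i is σN times the diagonal entry of the inverse Gram matrix.
  have hint : ∫⁻ ω in (fun ω n => a n ω) ⁻¹' E, ENNReal.ofReal (2 * ∑ i, Real.exp (-(r ^ 2 /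
        (2 * (b ^ 2 * (gram (Finset.range N) fun n => a n ω)⁻¹ i i))))) ∂P
      ≤ ∫⁻ ω in {ω | laplace N (fun n => g n ω) s₀ ≤ Real.exp (-s₀ / 2)},
        ENNReal.ofReal (2 * ∑ i, Real.exp (-(κ * L /
          (y i ⬝ᵥ (((N : ℝ)⁻¹ • gram (Finset.range N) fun n => g n ω)⁻¹ *ᵥ y i))))) ∂P := by
    refine setLIntegral_mono' (hE.preimage (measurable_pi_lambda _ ha)) fun ω hω => ?_
    refine ENNReal.ofReal_le_ofReal (mul_le_mul_of_nonneg_left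
      (Finset.sum_le_sum fun i _ => Real.exp_le_exp.2 (neg_le_neg ?_)) zero_le_two)
    obtain ⟨-, w, d, -, -, -, -, hpos, hinv, -⟩ := exists_spectral_weights
      ((isSymm_gram (Finset.range N) fun n => W *ᵥ a n ω).smul (N : ℝ)⁻¹) hy hy0 hs₀0 hω
    have ht : y i ⬝ᵥ (((N : ℝ)⁻¹ • gram (Finset.range N) fun n => g n ω)⁻¹ *ᵥ y i)
        = σ * N * (gram (Finset.range N) fun n => a n ω)⁻¹ i i := by
      have h := dotProduct_inv_whitening hW (inv_ne_zero hN0.ne') (hEu _ hω) i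
      rw [← hconj, inv_inv] at h
      simp only [hyd, mulVec_smul, smul_dotProduct, dotProduct_smul, smul_eq_mul]
      rw [← mul_assoc, hσs, mul_assoc, ← h]
    have htpos : 0 < σ * N * (gram (Finset.range N) fun n => a n ω)⁻¹ i i := by
      rw [← ht]
      exact (hpos i).trans_eq (hinv i).symm
    rw [ht]
    have hq : 0 < (gram (Finset.range N) fun n => a n ω)⁻¹ i i :=
      pos_of_mul_pos_right htpos (by positivity)
    rw [div_le_div_iff₀ htpos (by positivity)]
    have h1 : 2 * α ^ 2 * b ^ 2 * L ≤ N * (r ^ 2 * σ ^ 2) := by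
      rw [div_mul_eq_mul_div, div_le_iff₀ (by positivity)] at hNb
      exact hNb
    have h2 : κ * σ = α ^ 2 := by rw [hκd]; field_simp
    have h3 : κ * L * (2 * b ^ 2) * σ ≤ r ^ 2 * (σ * N) * σ := by
      rw [← h2] at h1
      nlinarith
    have h4 := le_of_mul_le_mul_right h3 hσ
    nlinarith [mul_le_mul_of_nonneg_right h4 hq.le]
  have hsub : {ω | ¬ IsUnit ((design a N ω)ᵀ * design a N ω) ∨
        r < ‖estimator (design a N ω) (output a v θ₀ N ω) - θ₀‖} ⊆
      {ω | Real.exp (-s₀ / 2) < laplace N (fun n => g n ω) s₀} ∪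
      {ω | (fun n => a n ω) ∈ E ∧ ∃ i, r < |∑ n ∈ Finset.range N,
        ((gram (Finset.range N) fun n => a n ω)⁻¹ *ᵥ a n ω) i * v n ω|} := by
    intro ω hω
    rcases lt_or_ge (Real.exp (-s₀ / 2)) (laplace N (fun n => g n ω) s₀) with h | h
    · exact Or.inl h
    have hE' : (fun n => a n ω) ∈ E := h
    have hu := hEu _ hE'
    refine Or.inr ⟨hE', ?_⟩
    rcases hω with hω | hω
    · rw [design_transpose_mul_self] at hω
      exact absurd hu hω
    by_contra! hcon
    refine absurd hω (not_lt.2 ((pi_norm_le_iff_of_nonneg hr.le).2 fun i => ?_))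
    rw [estimator_output_sub a v θ₀ N ω hu, Real.norm_eq_abs]
    exact hcon i
  exact (measure_mono hsub).trans ((measure_union_le _ _).trans
    ((add_le_add_right (hnoise.trans hint) _).trans hmain))

end Main

end LeastSquares

theorem theorem2 {Ω : Type*} [MeasurableSpace Ω] (P : Measure Ω) [IsProbabilityMeasure P]
    {p : ℕ} (hp : 0 < p) (θ₀ : Fin p → ℝ)
    -- the rows of the design matrix and the noise
    (a : ℕ → Ω → Fin p → ℝ) (v : ℕ → Ω → ℝ)
    (ha : ∀ n, Measurable (a n)) (hv : ∀ n, Measurable (v n))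
    (M : Matrix (Fin p) (Fin p) ℝ) (α b R : ℝ)
    -- the noise has zero mean
    (hmean : ∀ n, ∫ ω, v n ω ∂P = 0)
    -- the rows of the design matrix are independent
    (hrows : iIndepFun a P)
    -- A1: the design matrix has bounded entries
    (hA1 : ∀ n i, ∀ᵐ ω ∂P, |a n ω i| ≤ α)
    -- A2: the second moment matrix of the design, which is positive definite
    (hA2 : ∀ N : ℕ, 0 < N →
      M = (1 / (N : ℝ)) •
        LeastSquares.expMatrix P
          (fun ω => (LeastSquares.design a N ω)ᵀ * LeastSquares.design a N ω))
    (hM : M.PosDef)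
    -- A3: the noise variables are independent of each other and of the design matrix
    (hA3 : iIndepFun v P)
    (hA3' : IndepFun (fun ω n => a n ω) (fun ω n => v n ω) P)
    -- A4, A5: the noise has variance `R` and is bounded by `b`
    (hA4 : ∀ n, ∫ ω, v n ω ^ 2 ∂P = R)
    (hA5 : ∀ n, ∀ᵐ ω ∂P, |v n ω| ≤ b)
    (r ε : ℝ) (hr : 0 < r) (hε : 0 < ε) (N : ℕ)
    (hN : max
        (LeastSquares.nRand p α (LeastSquares.lambdaMax M) (LeastSquares.lambdaMin M) ε)
        (LeastSquares.nNoise p α b (LeastSquares.lambdaMin M) r ε) < (N : ℝ)) :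
    P.real {ω |
        ¬ IsUnit ((LeastSquares.design a N ω)ᵀ * LeastSquares.design a N ω) ∨
        r < ‖LeastSquares.estimator (LeastSquares.design a N ω)
              (LeastSquares.output a v θ₀ N ω) - θ₀‖} ≤ ε := by
  rcases le_or_gt 1 ε with hε1 | hε1
  · exact measureReal_le_one.trans hε1
  obtain ⟨h1, h2⟩ := max_lt_iff.1 hN
  have hσ := LeastSquares.lambdaMin_pos hp hM
  have hσ' := LeastSquares.lambdaMin_le_lambdaMax hp hM
  have hτ : 0 ≤ 6 * LeastSquares.lambdaMax M + LeastSquares.lambdaMin M := by linarith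
  have hcov := LeastSquares.integral_mul_eq_of_expMatrix ha hA1 hA2
  rw [LeastSquares.nRand] at h1
  rw [LeastSquares.nNoise] at h2
  set σ := LeastSquares.lambdaMin M with hσd
  set τ := LeastSquares.lambdaMax M
  set L := Real.log (3 * p / ε) with hLd
  have hp1 : (1 : ℝ) ≤ p := by exact_mod_cast hp
  have hL : Real.log (3 * p) ≤ L :=
    Real.log_le_log (by positivity) (le_div_self (by positivity) hε hε1.le)
  have hL0 : 0 < L := lt_of_lt_of_le (Real.log_pos (by linarith)) hL
  have hexp : 3 * (p * Real.exp (-L)) = ε := by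
    rw [hLd, Real.exp_neg, Real.exp_log (by positivity)]
    field_simp
  -- The sample size increases with the largest eigenvalue, so that eigenvalue may be lowered to σ;
  -- 28/3 is 4/3·(6+1).
  have hN1 : 28 / 3 * (p * (α ^ 2 / σ) + 1) * L ≤ N := by
    refine le_trans ?_ h1.le
    refine mul_le_mul_of_nonneg_right ?_ hL0.le
    calc 28 / 3 * (p * (α ^ 2 / σ) + 1)
        = 4 / 3 * ((6 * σ + σ) * (p * α ^ 2 + σ) / σ ^ 2) := by field_simp; ring
      _ ≤ _ := by gcongr
  have hN0 : (0 : ℝ) < N := lt_of_lt_of_le (by positivity) hN1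
  -- enlarging `b` makes it positive and the second condition on `N` an equality
  have hα : 0 < α ^ 2 := hσ.trans_le (LeastSquares.lambdaMin_le_sq hp hM hA1 hcov)
  have hα0 : α ≠ 0 := sq_pos_iff.1 hα
  set c := r ^ 2 * σ ^ 2 * N / (2 * α ^ 2 * L) with hc
  have hc0 : 0 < c := by positivity
  have hbc : b ≤ √c := by
    refine Real.le_sqrt_of_sq_le ?_
    rw [hc, le_div_iff₀ (by positivity)]
    rw [div_mul_eq_mul_div, div_lt_iff₀ (by positivity)] at h2
    nlinarith
  have hmain := LeastSquares.measure_failure_le hp θ₀ ha hv hmean hrows hA1 hM hcov hA3 hA3'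
    (Real.sqrt_pos.2 hc0) (fun n => (hA5 n).mono fun ω h => h.trans hbc) hr hL hN1 (by
      rw [Real.sq_sqrt hc0.le, hc, ← hσd]
      refine le_of_eq ?_
      field_simp)
  rw [hexp] at hmain
  exact ENNReal.toReal_le_of_le_ofReal hε.le hmain
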